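/- Let $R$ be a coherent ring, meaning that the category $\mathrm{mod}(R)$ of finitely presented right $R$-modules and the category $\mathrm{mod}(R^{op})$ of finitely presented left $R$-modules are abelian. Let $\mathrm{Mod}(R)$ and $\mathrm{Mod}(R^{op})$ be the categories of all right and of all left $R$-modules. A functor $F$ from $\mathrm{Mod}(R)$ to the category $\mathrm{Ab}$ of abelian groups is finitely presented if there is an exact sequence $(Y,-)\to(X,-)\to F\to 0$ with $X,Y\in\mathrm{Mod}(R)$, where $(X,-)=\mathrm{Hom}(X,-)$, and totally finitely presented if one can choose $X,Y\in\mathrm{mod}(R)$; the same is said for functors on $\mathrm{Mod}(R^{op})$. The finitely presented functors form an abelian category $\mathrm{fp}(\mathrm{Mod}(R),\mathrm{Ab})$ with enough injectives; let $\mathrm{tfp}(\mathrm{Mod}(R),\mathrm{Ab})$ be its full subcategory of totally finitely presented functors. Exactness of a sequence of functors means exactness at every module. For $F\in\mathrm{fp}(\mathrm{Mod}(R),\mathrm{Ab})$ let $\mathsf Y_R(F)=(F(R),-)$, a functor on $\mathrm{Mod}(R^{op})$, where $r\in R$ acts on $F(R)$ by $F(r\cdot-)$, and let $D_R\colon\mathrm{fp}(\mathrm{Mod}(R),\mathrm{Ab})^{op}\to\mathrm{fp}(\mathrm{Mod}(R^{op}),\mathrm{Ab})$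 be the zeroth left derived functor of the contravariant functor $\mathsf Y_R$, computed by injective resolutions in $\mathrm{fp}(\mathrm{Mod}(R),\mathrm{Ab})$. Then $D_R$ carries totally finitely presented functors to totally finitely presented functors, and its restriction $D\colon\mathrm{tfp}(\mathrm{Mod}(R),\mathrm{Ab})^{op}\to\mathrm{tfp}(\mathrm{Mod}(R^{op}),\mathrm{Ab})$ is an exact duality (an exact equivalence of categories) with the following properties. 1. There are isomorphisms of abelian groups $e_{F,A}\colon DF(A)\cong\mathrm{Nat}(F,-\otimes_R A)$, natural in $F\in\mathrm{tfp}(\mathrm{Mod}(R),\mathrm{Ab})$ and $A\in\mathrm{Mod}(R^{op})$. 2. There are isomorphisms $\theta_X\colon D(X,-)\cong X\otimes_R-$, natural in $X\in\mathrm{mod}(R)$, such that for every map $f\colon X\to Y$ in $\mathrm{mod}(R)$ and every exact sequence $(Y,-)\xrightarrow{(f,-)}(X,-)\xrightarrow{\pi}F\to0$ the sequence $0\to DF\xrightarrow{\theta_X\circ D\pi}X\otimes_R-\xrightarrow{f\otimes-}Y\otimes_R-$ is exact. As a result: 3. $D$ is the Auslander–Gruson–Jensen duality: besides 1, for $A\in\mathrm{mod}(R^{op})$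 the map $e_{F,A}$ followed by restriction to $\mathrm{mod}(R)$ is a bijection from $DF(A)$ to the natural transformations $F|_{\mathrm{mod}(R)}\to(-\otimes_RA)|_{\mathrm{mod}(R)}$. 4. $D$ is the duality studied by Hartshorne: up to natural isomorphism, it is the only exact contravariant functor $E$ from $\mathrm{tfp}(\mathrm{Mod}(R),\mathrm{Ab})$ to $\mathrm{tfp}(\mathrm{Mod}(R^{op}),\mathrm{Ab})$ with $E(X,-)\cong X\otimes_R-$ naturally in $X\in\mathrm{mod}(R)$. 5. $D$ is the duality of pairs of pp-formulas of Prest, Herzog and Burke. A pp-formula $\varphi(x)$ in $n$ free variables for right modules has the form $\exists y\,(xA+yB=0)$ with matrices $A,B$ over $R$; its dual $D\varphi$ is the pp-formula $\exists z\,(x+Az=0\wedge Bz=0)$ for left modules. Write $\psi\le\varphi$ if $\psi(M)\subseteq\varphi(M)$ for all $M$, and let $F_{\varphi/\psi}$ be the functor $M\mapsto\varphi(M)/\psi(M)$. Every totally finitely presented functor on $\mathrm{Mod}(R)$ is isomorphic to some $F_{\varphi/\psi}$ with $\psi\le\varphi$. If $\psi\le\varphi$, then $D\varphi\le D\psi$,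 the functor $F_{\varphi/\psi}$ is totally finitely presented, and there is an isomorphism $D(F_{\varphi/\psi})\cong F_{D\psi/D\varphi}$ under which, for $N\in\mathrm{Mod}(R^{op})$, the class of $b\in D\psi(N)$ corresponds by $e_{F_{\varphi/\psi},N}$ to the transformation $\varphi(M)/\psi(M)\to M\otimes_RN$, $[a]\mapsto\sum_k a_k\otimes b_k$. -/

import Mathlib

open CategoryTheory CategoryTheory.Limits Opposite
universe u v

set_option linter.unusedSectionVars false

namespace FunctorDuality

noncomputable section

section FinitelyPresented

open scoped ZeroObject

variable {C : Type u} [Category.{v} C] [Abelian C]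

/-- The covariant representable functor `(X, -)`, with values in abelian groups. -/
abbrev rep (X : C) : C ⥤ AddCommGrpCat.{v} := preadditiveCoyoneda.obj (op X)

/-- `F` has a presentation `(Y, -) ⟶ (X, -) ⟶ F ⟶ 0` with `X` and `Y` satisfying `P`. -/
def HasPresentation (P : ObjectProperty C) : ObjectProperty (C ⥤ AddCommGrpCat.{v}) :=
  fun F => ∃ (X Y : C) (_ : P X) (_ : P Y) (α : rep Y ⟶ rep X), Nonempty (F ≅ cokernel α)

/-- Finitely presented functors. -/
abbrev isFP : ObjectProperty (C ⥤ AddCommGrpCat.{v}) := HasPresentation ⊤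

/-- An elementary form of a presentation: `x : F(X)` generates `F` and its relations are
generated by `f : X ⟶ Y`. -/
structure Presents (F : C ⥤ AddCommGrpCat.{v}) {X Y : C} (f : X ⟶ Y) (x : F.obj X) : Prop where
  gen : ∀ (A : C) (z : F.obj A), ∃ h : X ⟶ A, F.map h x = z
  rel : ∀ (A : C) (h : X ⟶ A), F.map h x = 0 ↔ ∃ k : Y ⟶ A, f ≫ k = h

lemma map_add_apply (F : C ⥤ AddCommGrpCat.{v}) [F.Additive] {X A : C} (h h' : X ⟶ A)
    (x : F.obj X) : F.map (h + h') x = F.map h x + F.map h' x := by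
  rw [F.map_add]; rfl

lemma map_sub_apply (F : C ⥤ AddCommGrpCat.{v}) [F.Additive] {X A : C} (h h' : X ⟶ A)
    (x : F.obj X) : F.map (h - h') x = F.map h x - F.map h' x := by
  rw [F.map_sub]; rfl

lemma map_neg_apply (F : C ⥤ AddCommGrpCat.{v}) [F.Additive] {X A : C} (h : X ⟶ A)
    (x : F.obj X) : F.map (-h) x = - F.map h x := by
  rw [F.map_neg]; rfl

lemma map_zero_apply (F : C ⥤ AddCommGrpCat.{v}) [F.Additive] {X A : C}
    (x : F.obj X) : F.map (0 : X ⟶ A) x = 0 := by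
  rw [F.map_zero]; rfl

lemma map_comp_apply' (F : C ⥤ AddCommGrpCat.{v}) {X A B : C} (h : X ⟶ A) (k : A ⟶ B)
    (x : F.obj X) : F.map (h ≫ k) x = F.map k (F.map h x) := by
  rw [F.map_comp]; rfl

lemma map_id_apply' (F : C ⥤ AddCommGrpCat.{v}) {X : C} 
    (x : F.obj X) : F.map (𝟙 X) x = x := by
  rw [F.map_id]; rfl

lemma nat_apply {F G : C ⥤ AddCommGrpCat.{v}} (α : F ⟶ G) {A B : C} (h : A ⟶ B) (z : F.obj A) :
    α.app B (F.map h z) = G.map h (α.app A z) := by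
  exact ConcreteCategory.congr_hom (α.naturality h) z

/-- The natural transformation out of a presented functor determined by an element. -/
lemma Presents.exists_hom {F G : C ⥤ AddCommGrpCat.{v}} [F.Additive] [G.Additive] {X Y : C}
    {f : X ⟶ Y} {x : F.obj X} (h : Presents F f x) (i : G.obj X) (hi : G.map f i = 0) :
    ∃ α : F ⟶ G, α.app X x = i := by
  choose s hs using h.gen
  have key : ∀ (A : C) (k k' : X ⟶ A), F.map k x = F.map k' x → G.map k i = G.map k' i := by
    intro A k k' e
    have : F.map (k - k') x = 0 := by rw [map_sub_apply, e, sub_self]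
    obtain ⟨l, hl⟩ := (h.rel A _).1 this
    rw [← sub_eq_zero, ← map_sub_apply, ← hl, map_comp_apply', hi, map_zero]
  refine ⟨{ app := fun A => AddCommGrpCat.ofHom
              (AddMonoidHom.mk' (fun z => G.map (s A z) i) fun a b => ?_)
            naturality := fun A B g => ?_ }, ?_⟩
  · rw [← map_add_apply]
    apply key
    rw [map_add_apply, hs, hs, hs]
  · ext z
    change G.map (s B (F.map g z)) i = G.map g (G.map (s A z) i)
    rw [← map_comp_apply']
    apply key
    rw [hs, map_comp_apply', hs]
  · change G.map (s X x) i = i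
    conv_rhs => rw [← map_id_apply' G i]
    apply key
    rw [hs, map_id_apply']

lemma Presents.hom_ext {F G : C ⥤ AddCommGrpCat.{v}} {X Y : C}
    {f : X ⟶ Y} {x : F.obj X} (h : Presents F f x) {α β : F ⟶ G}
    (e : α.app X x = β.app X x) : α = β := by
  ext A z
  obtain ⟨k, rfl⟩ := h.gen A z
  rw [nat_apply, nat_apply, e]

/-- An exact sequence of functors is exact at every object. -/
lemma exact_app {F G H : C ⥤ AddCommGrpCat.{v}} {α : F ⟶ G} {β : G ⟶ H} {w : α ≫ β = 0}
    (h : (ShortComplex.mk α β w).Exact) (A : C) : Function.Exact (α.app A) (β.app A) := by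
  have := h.map ((evaluation C AddCommGrpCat.{v}).obj A)
  rwa [ShortComplex.ab_exact_iff_function_exact] at this

lemma presents_cokernel {X Y : C} (α : rep Y ⟶ rep X) (f : X ⟶ Y)
    (hf : α.app Y (𝟙 Y : Y ⟶ Y) = f) : ∃ x : (cokernel α).obj X, Presents (cokernel α) f x := by
  have hex := exact_app (ShortComplex.exact_cokernel α)
  have hsurj : ∀ A, Function.Surjective ((cokernel.π α).app A) := fun A =>
    (AddCommGrpCat.epi_iff_surjective _).1 inferInstance
  have h1 : ∀ (A : C) (h : X ⟶ A), (cokernel α).map h ((cokernel.π α).app X (𝟙 X : X ⟶ X)) =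
      (cokernel.π α).app A h := by
    intro A h
    have := nat_apply (cokernel.π α) h (𝟙 X : X ⟶ X)
    rw [← this]
    congr 1
    exact Category.id_comp h
  have h2 : ∀ (A : C) (k : Y ⟶ A), α.app A k = f ≫ k := by
    intro A k
    have := nat_apply α k (𝟙 Y : Y ⟶ Y)
    rw [hf] at this
    refine Eq.trans ?_ this
    congr 1
    exact (Category.id_comp k).symm
  refine ⟨(cokernel.π α).app X (𝟙 X : X ⟶ X), ⟨fun A z => ?_, fun A h => ?_⟩⟩
  · obtain ⟨h, hh⟩ := hsurj A z
    exact ⟨h, (h1 A h).trans hh⟩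
  · rw [h1]
    refine (hex A h).trans ⟨?_, ?_⟩
    · rintro ⟨k, hk⟩
      exact ⟨k, (h2 A k).symm.trans hk⟩
    · rintro ⟨k, hk⟩
      exact ⟨k, (h2 A k).trans hk⟩

lemma additive_of_surjective {F G : C ⥤ AddCommGrpCat.{v}} [F.Additive] (α : F ⟶ G)
    (h : ∀ A, Function.Surjective (α.app A)) : G.Additive where
  map_add {X Y f g} := by
    ext z
    obtain ⟨y, rfl⟩ := h X z
    change G.map (f + g) (α.app X y) = G.map f (α.app X y) + G.map g (α.app X y)
    rw [← nat_apply, ← nat_apply, ← nat_apply, map_add_apply, map_add]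

lemma additive_of_injective {F G : C ⥤ AddCommGrpCat.{v}} [G.Additive] (α : F ⟶ G)
    (h : ∀ A, Function.Injective (α.app A)) : F.Additive where
  map_add {X Y f g} := by
    ext z
    change F.map (f + g) z = F.map f z + F.map g z
    apply h
    rw [map_add, nat_apply, nat_apply, nat_apply, map_add_apply]

lemma Presents.of_iso {F G : C ⥤ AddCommGrpCat.{v}} (e : F ≅ G) {X Y : C} {f : X ⟶ Y}
    {x : F.obj X} (h : Presents F f x) : Presents G f (e.hom.app X x) where
  gen A z := by
    obtain ⟨k, hk⟩ := h.gen A (e.inv.app A z)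
    refine ⟨k, ?_⟩
    rw [← nat_apply, hk]
    exact ConcreteCategory.congr_hom (e.inv_hom_id_app A) z
  rel A k := by
    rw [← h.rel, ← nat_apply]
    refine ⟨fun h0 => ?_, fun h0 => by rw [h0, map_zero]⟩
    have := congrArg (e.inv.app A) h0
    rw [map_zero] at this
    rw [← this]
    exact (ConcreteCategory.congr_hom (e.hom_inv_id_app A) _).symm

lemma HasPresentation.exists_presents {P : ObjectProperty C} {F : C ⥤ AddCommGrpCat.{v}}
    (h : HasPresentation P F) :
    F.Additive ∧ ∃ (X Y : C) (_ : P X) (_ : P Y) (f : X ⟶ Y) (x : F.obj X), Presents F f x := by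
  obtain ⟨X, Y, hX, hY, α, ⟨e⟩⟩ := h
  obtain ⟨x, hx⟩ := presents_cokernel α _ rfl
  refine ⟨?_, X, Y, hX, hY, _, _, hx.of_iso e.symm⟩
  refine additive_of_surjective (cokernel.π α ≫ e.inv) fun A => ?_
  exact (AddCommGrpCat.epi_iff_surjective _).1 inferInstance

lemma Presents.hasPresentation {P : ObjectProperty C} {F : C ⥤ AddCommGrpCat.{v}} [F.Additive]
    {X Y : C} (hX : P X) (hY : P Y) {f : X ⟶ Y} {x : F.obj X} (h : Presents F f x) :
    HasPresentation P F := by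
  let α : rep Y ⟶ rep X := preadditiveCoyoneda.map f.op
  obtain ⟨y, hy⟩ := presents_cokernel α f (Category.comp_id f)
  have : (cokernel α).Additive := additive_of_surjective (cokernel.π α) fun A =>
    (AddCommGrpCat.epi_iff_surjective _).1 inferInstance
  obtain ⟨a, ha⟩ := h.exists_hom y ((hy.rel _ _).2 ⟨𝟙 Y, Category.comp_id f⟩)
  obtain ⟨b, hb⟩ := hy.exists_hom x ((h.rel _ _).2 ⟨𝟙 Y, Category.comp_id f⟩)
  refine ⟨X, Y, hX, hY, α, ⟨⟨a, b, h.hom_ext ?_, hy.hom_ext ?_⟩⟩⟩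
  · change b.app X (a.app X x) = x
    rw [ha, hb]
  · change a.app X (b.app X y) = y
    rw [hb, ha]

lemma isFP_iff (F : C ⥤ AddCommGrpCat.{v}) :
    isFP F ↔ F.Additive ∧ ∃ (X Y : C) (f : X ⟶ Y) (x : F.obj X), Presents F f x := by
  constructor
  · intro h
    obtain ⟨h1, X, Y, -, -, f, x, hx⟩ := HasPresentation.exists_presents h
    exact ⟨h1, X, Y, f, x, hx⟩
  · rintro ⟨h1, X, Y, f, x, hx⟩
    exact hx.hasPresentation (by trivial) (by trivial)

lemma rep_presents_id (X : C) : Presents (rep X) (0 : X ⟶ X) (𝟙 X : X ⟶ X) where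
  gen A z := ⟨z, Category.id_comp _⟩
  rel A h := by
    have : (rep X).map h (𝟙 X : X ⟶ X) = h := Category.id_comp h
    rw [this]
    refine ⟨fun h0 => ⟨0, by rw [h0, comp_zero]; rfl⟩, ?_⟩
    rintro ⟨k, rfl⟩
    exact zero_comp

lemma isFP_rep (X : C) : isFP (rep X) :=
  (isFP_iff _).2 ⟨inferInstance, _, _, _, _, rep_presents_id X⟩

instance : (isFP (C := C)).ContainsZero where
  exists_zero := by
    refine ⟨cokernel (𝟙 (rep (0 : C))), ?_, 0, 0, trivial, trivial, 𝟙 _, ⟨Iso.refl _⟩⟩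
    exact isZero_cokernel_of_epi _

instance : (isFP (C := C)).IsClosedUnderKernels where
  kernels_le := by
    rintro K ⟨α, k, hk, hF, hG⟩
    rename_i F G
    obtain ⟨hFa, X₀, X₁, f, x, hx⟩ := (isFP_iff _).1 hF
    obtain ⟨hGa, Y₀, Y₁, g, y, hy⟩ := (isFP_iff _).1 hG
    have hmono : Mono k.ι := Fork.IsLimit.mono hk
    have hinj : ∀ A, Function.Injective (k.ι.app A) := fun A =>
      (AddCommGrpCat.mono_iff_injective _).1 inferInstance
    have hex := exact_app (ShortComplex.exact_of_f_is_kernel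
      (ShortComplex.mk k.ι α k.condition) (IsLimit.ofIsoLimit hk (Fork.ext (Iso.refl _))))
    have hKa : k.pt.Additive := additive_of_injective k.ι hinj
    obtain ⟨a, ha⟩ := hy.gen X₀ (α.app X₀ x)
    let Q := pushout a g
    have hq : α.app Q (F.map (pushout.inl a g) x) = 0 := by
      rw [nat_apply, ← ha, ← map_comp_apply', pushout.condition, map_comp_apply',
        (hy.rel _ g).2 ⟨𝟙 _, Category.comp_id g⟩, map_zero]
    obtain ⟨q, hq⟩ := (hex Q _).1 hq
    refine (isFP_iff _).2 ⟨hKa, Q, pushout (pushout.inl a g) f, pushout.inl _ _, q, ?_, ?_⟩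
    · intro A z
      obtain ⟨h, hh⟩ := hx.gen A (k.ι.app A z)
      have h0 : G.map (a ≫ h) y = 0 := by
        rw [map_comp_apply', ha, ← nat_apply, hh]
        exact (hex A _).2 ⟨z, rfl⟩
      obtain ⟨l, hl⟩ := (hy.rel _ _).1 h0
      refine ⟨pushout.desc h l hl.symm, hinj A ?_⟩
      rw [nat_apply, hq, ← map_comp_apply', pushout.inl_desc, hh]
    · intro A t
      have h1 : k.pt.map t q = 0 ↔ F.map (pushout.inl a g ≫ t) x = 0 := by
        rw [map_comp_apply', ← hq, ← nat_apply]
        exact ⟨fun h => by rw [h, map_zero], fun h => hinj A (by rw [h, map_zero])⟩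
      rw [h1, hx.rel]
      constructor
      · rintro ⟨l, hl⟩
        exact ⟨pushout.desc t l hl.symm, pushout.inl_desc _ _ _⟩
      · rintro ⟨l, rfl⟩
        refine ⟨pushout.inr _ _ ≫ l, ?_⟩
        rw [← Category.assoc, ← pushout.condition, Category.assoc]

instance : (isFP (C := C)).IsClosedUnderCokernels where
  cokernels_le := by
    rintro K ⟨α, k, hk, hF, hG⟩
    rename_i F G
    obtain ⟨hFa, X₀, X₁, f, x, hx⟩ := (isFP_iff _).1 hF
    obtain ⟨hGa, Y₀, Y₁, g, y, hy⟩ := (isFP_iff _).1 hG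
    have hepi : Epi k.π := Cofork.IsColimit.epi hk
    have hsurj : ∀ A, Function.Surjective (k.π.app A) := fun A =>
      (AddCommGrpCat.epi_iff_surjective _).1 inferInstance
    have hex := exact_app (ShortComplex.exact_of_g_is_cokernel
      (ShortComplex.mk α k.π k.condition) (IsColimit.ofIsoColimit hk (Cofork.ext (Iso.refl _))))
    have hKa : k.pt.Additive := additive_of_surjective k.π hsurj
    obtain ⟨a, ha⟩ := hy.gen X₀ (α.app X₀ x)
    refine (isFP_iff _).2 ⟨hKa, Y₀, Y₁ ⊞ X₀, biprod.lift g a, k.π.app Y₀ y, ?_, ?_⟩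
    · intro A z
      obtain ⟨w, rfl⟩ := hsurj A z
      obtain ⟨h, rfl⟩ := hy.gen A w
      exact ⟨h, (nat_apply _ _ _).symm⟩
    · intro A h
      rw [← nat_apply]
      refine (hex A _).trans ?_
      constructor
      · rintro ⟨w, hw⟩
        obtain ⟨l, rfl⟩ := hx.gen A w
        have : G.map (h - a ≫ l) y = 0 := by
          rw [map_sub_apply, map_comp_apply', ha, ← nat_apply, sub_eq_zero]
          exact hw.symm
        obtain ⟨m, hm⟩ := (hy.rel _ _).1 this
        exact ⟨biprod.desc m l, by simp [hm]⟩
      · rintro ⟨m, rfl⟩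
        refine ⟨F.map (biprod.inr ≫ m) x, ?_⟩
        have hg := (hy.rel _ g).2 ⟨𝟙 _, Category.comp_id g⟩
        have : biprod.lift g a ≫ m = g ≫ (biprod.inl ≫ m) + a ≫ (biprod.inr ≫ m) := by
          rw [biprod.lift_eq]; simp
        rw [this, map_add_apply, map_comp_apply' G g, hg, map_zero, zero_add, nat_apply,
          map_comp_apply' G a, ha]

instance : (isFP (C := C)).IsClosedUnderIsomorphisms where
  of_iso e h := by
    obtain ⟨X, Y, hX, hY, α, ⟨i⟩⟩ := h
    exact ⟨X, Y, hX, hY, α, ⟨e.symm ≪≫ i⟩⟩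

lemma isFP_biprod {F G : C ⥤ AddCommGrpCat.{v}} (hF : isFP F) (hG : isFP G) :
    isFP (F ⊞ G) := by
  obtain ⟨hFa, X₀, X₁, f, x, hx⟩ := (isFP_iff _).1 hF
  obtain ⟨hGa, Y₀, Y₁, g, y, hy⟩ := (isFP_iff _).1 hG
  have e1 : ∀ (A : C) (z : (F ⊞ G : C ⥤ AddCommGrpCat.{v}).obj A),
      (biprod.inl : F ⟶ F ⊞ G).app A ((biprod.fst : F ⊞ G ⟶ F).app A z) +
      (biprod.inr : G ⟶ F ⊞ G).app A ((biprod.snd : F ⊞ G ⟶ G).app A z) = z := fun A z =>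
    ConcreteCategory.congr_hom (NatTrans.congr_app (biprod.total (X := F) (Y := G)) A) z
  have e2 : ∀ (A : C) (z : F.obj A), (biprod.fst : F ⊞ G ⟶ F).app A
      ((biprod.inl : F ⟶ F ⊞ G).app A z) = z := fun A z =>
    ConcreteCategory.congr_hom (NatTrans.congr_app (biprod.inl_fst (X := F) (Y := G)) A) z
  have e3 : ∀ (A : C) (z : F.obj A), (biprod.snd : F ⊞ G ⟶ G).app A
      ((biprod.inl : F ⟶ F ⊞ G).app A z) = 0 := fun A z =>
    ConcreteCategory.congr_hom (NatTrans.congr_app (biprod.inl_snd (X := F) (Y := G)) A) z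
  have e4 : ∀ (A : C) (z : G.obj A), (biprod.fst : F ⊞ G ⟶ F).app A
      ((biprod.inr : G ⟶ F ⊞ G).app A z) = 0 := fun A z =>
    ConcreteCategory.congr_hom (NatTrans.congr_app (biprod.inr_fst (X := F) (Y := G)) A) z
  have e5 : ∀ (A : C) (z : G.obj A), (biprod.snd : F ⊞ G ⟶ G).app A
      ((biprod.inr : G ⟶ F ⊞ G).app A z) = z := fun A z =>
    ConcreteCategory.congr_hom (NatTrans.congr_app (biprod.inr_snd (X := F) (Y := G)) A) z
  have e6 : ∀ {A B : C} (h : A ⟶ B) (z : (F ⊞ G : C ⥤ AddCommGrpCat.{v}).obj A),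
      (F ⊞ G : C ⥤ AddCommGrpCat.{v}).map h z =
      (biprod.inl : F ⟶ F ⊞ G).app B (F.map h ((biprod.fst : F ⊞ G ⟶ F).app A z)) +
      (biprod.inr : G ⟶ F ⊞ G).app B (G.map h ((biprod.snd : F ⊞ G ⟶ G).app A z)) := by
    intro A B h z
    rw [nat_apply, nat_apply, ← map_add, e1]
  have hadd : (F ⊞ G : C ⥤ AddCommGrpCat.{v}).Additive := ⟨fun {A B h k} => by
    ext z
    change (F ⊞ G : C ⥤ AddCommGrpCat.{v}).map (h + k) z =
      (F ⊞ G : C ⥤ AddCommGrpCat.{v}).map h z + (F ⊞ G : C ⥤ AddCommGrpCat.{v}).map k z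
    rw [e6, e6, e6, map_add_apply, map_add_apply, map_add, map_add]
    abel⟩
  refine (isFP_iff _).2 ⟨hadd, X₀ ⊞ Y₀, X₁ ⊞ Y₁, biprod.map f g,
    (biprod.inl : F ⟶ F ⊞ G).app _ (F.map biprod.inl x) +
    (biprod.inr : G ⟶ F ⊞ G).app _ (G.map biprod.inr y), ?_, ?_⟩
  · intro A z
    obtain ⟨h, hh⟩ := hx.gen A ((biprod.fst : F ⊞ G ⟶ F).app A z)
    obtain ⟨k, hk⟩ := hy.gen A ((biprod.snd : F ⊞ G ⟶ G).app A z)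
    refine ⟨biprod.desc h k, ?_⟩
    rw [map_add, ← nat_apply, ← nat_apply, ← map_comp_apply', ← map_comp_apply',
      biprod.inl_desc, biprod.inr_desc, hh, hk, e1]
  · intro A h
    have key : (F ⊞ G : C ⥤ AddCommGrpCat.{v}).map h
        ((biprod.inl : F ⟶ F ⊞ G).app _ (F.map biprod.inl x) +
          (biprod.inr : G ⟶ F ⊞ G).app _ (G.map biprod.inr y)) = 0 ↔
        F.map (biprod.inl ≫ h) x = 0 ∧ G.map (biprod.inr ≫ h) y = 0 := by
      rw [map_add, ← nat_apply, ← nat_apply, ← map_comp_apply', ← map_comp_apply']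
      constructor
      · intro h0
        constructor
        · have := congrArg ((biprod.fst : F ⊞ G ⟶ F).app A) h0
          rwa [map_add, e2, e4, add_zero, map_zero] at this
        · have := congrArg ((biprod.snd : F ⊞ G ⟶ G).app A) h0
          rwa [map_add, e3, e5, zero_add, map_zero] at this
      · rintro ⟨h1, h2⟩
        rw [h1, h2, map_zero, map_zero, add_zero]
    rw [key, hx.rel, hy.rel]
    constructor
    · rintro ⟨⟨k, hk⟩, l, hl⟩
      refine ⟨biprod.desc k l, ?_⟩
      apply biprod.hom_ext' <;> simp [hk, hl]
    · rintro ⟨k, rfl⟩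
      exact ⟨⟨biprod.inl ≫ k, by simp⟩, ⟨biprod.inr ≫ k, by simp⟩⟩

instance : (isFP (C := C)).IsClosedUnderBinaryProducts where
  limitsOfShape_le := by
    rintro K ⟨p⟩
    have h := isFP_biprod (p.prop_diag_obj ⟨.left⟩) (p.prop_diag_obj ⟨.right⟩)
    refine (isFP (C := C)).prop_of_iso ?_ h
    exact ((BinaryBiproduct.isLimit _ _).conePointUniqueUpToIso
      ((IsLimit.postcomposeHomEquiv (diagramIsoPair p.diag) _).symm p.isLimit))

instance : (isFP (C := C)).IsClosedUnderFiniteProducts := .mk'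

variable (C) in
/-- The abelian category `fp(C, Ab)` of finitely presented functors. -/
abbrev FP := (isFP (C := C)).FullSubcategory

/-- A finitely presented functor presented by a map between projectives is right exact:
it carries right exact sequences to right exact sequences. -/
lemma Presents.exact_of_projective {I : C ⥤ AddCommGrpCat.{v}} [I.Additive] {P Q : C}
    [Projective P] [Projective Q] {f : P ⟶ Q} {x : I.obj P} (h : Presents I f x)
    {U V : C} (a : U ⟶ V) (v : I.obj V) (hv : I.map (cokernel.π a) v = 0) :
    ∃ u : I.obj U, I.map a u = v := by
  obtain ⟨k, rfl⟩ := h.gen V v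
  rw [← map_comp_apply', h.rel] at hv
  obtain ⟨l, hl⟩ := hv
  have h0 : (k - f ≫ Projective.factorThru l (cokernel.π a)) ≫ cokernel.π a = 0 := by
    rw [Preadditive.sub_comp, Category.assoc, Projective.factorThru_comp, hl, sub_self]
  have hex : (ShortComplex.mk a (cokernel.π a) (cokernel.condition a)).Exact :=
    ShortComplex.exact_cokernel a
  refine ⟨I.map (hex.liftFromProjective _ h0) x, ?_⟩
  have h1 : hex.liftFromProjective _ h0 ≫ a = _ := hex.liftFromProjective_comp _ h0
  rw [← map_comp_apply', h1, map_sub_apply, sub_eq_self, h.rel]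
  exact ⟨_, rfl⟩

lemma injective_of_presents (I : FP C) {P Q : C} [Projective P] [Projective Q] {f : P ⟶ Q}
    {x : I.obj.obj P} (h : Presents I.obj f x) : Injective I where
  factors {A B} φ m hm := by
    have hI : I.obj.Additive := ((isFP_iff _).1 I.property).1
    obtain ⟨hAa, X₀, X₁, f, a, ha⟩ := (isFP_iff _).1 A.property
    obtain ⟨hBa, Y₀, Y₁, g, b, hb⟩ := (isFP_iff _).1 B.property
    have : (isFP (C := C)).ι.PreservesMonomorphisms :=
      ObjectProperty.preservesMonomorphisms_ι_of_isNormalEpiCategory _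
    have hm' : Mono m.hom := inferInstanceAs (Mono ((isFP (C := C)).ι.map m))
    have hinj : ∀ A, Function.Injective (m.hom.app A) := fun A =>
      (AddCommGrpCat.mono_iff_injective _).1 inferInstance
    obtain ⟨c, hc⟩ := hb.gen X₀ (m.hom.app X₀ a)
    have hg : B.obj.map g b = 0 := (hb.rel _ g).2 ⟨𝟙 _, Category.comp_id g⟩
    have hf : A.obj.map f a = 0 := (ha.rel _ f).2 ⟨𝟙 _, Category.comp_id f⟩
    let w : Y₀ ⟶ X₀ ⊞ Y₁ := biprod.lift c (-g)
    have hw : c ≫ biprod.inl ≫ cokernel.π w = g ≫ biprod.inr ≫ cokernel.π w := by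
      have := cokernel.condition w
      rw [← sub_eq_zero, ← this]
      simp only [w, biprod.lift_eq, Preadditive.add_comp, Preadditive.neg_comp, Category.assoc]
      abel
    have h0 : A.obj.map (biprod.inl ≫ cokernel.π w) a = 0 := by
      apply hinj
      rw [nat_apply, ← hc, ← map_comp_apply', hw, map_comp_apply', hg, map_zero, map_zero]
    obtain ⟨t, ht⟩ := (ha.rel _ _).1 h0
    obtain ⟨j, hj⟩ := h.exact_of_projective w (I.obj.map biprod.inl (φ.hom.app X₀ a)) (by
      rw [← map_comp_apply', ← nat_apply, ← ht, map_comp_apply', hf, map_zero, map_zero])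
    have hj1 := congrArg (I.obj.map biprod.fst) hj
    have hj2 := congrArg (I.obj.map biprod.snd) hj
    rw [← map_comp_apply', ← map_comp_apply', biprod.lift_fst, biprod.inl_fst,
      map_id_apply'] at hj1
    rw [← map_comp_apply', ← map_comp_apply', biprod.lift_snd, biprod.inl_snd,
      map_zero_apply, map_neg_apply, neg_eq_zero] at hj2
    obtain ⟨ψ, hψ⟩ := hb.exists_hom j hj2
    refine ⟨ObjectProperty.homMk ψ, ?_⟩
    ext1
    refine ha.hom_ext ?_
    change ψ.app X₀ (m.hom.app X₀ a) = _
    rw [← hc, nat_apply, hψ, hj1]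

instance [EnoughProjectives C] : EnoughInjectives (FP C) where
  presentation F := by
    obtain ⟨hFa, X, Y, f, x, hx⟩ := (isFP_iff _).1 F.property
    let q := Projective.π Y
    let l := Projective.factorThru (Projective.π X ≫ f) q
    have hl : l ≫ q = Projective.π X ≫ f := Projective.factorThru_comp _ _
    let L := Projective.over (kernel q)
    let φ : Projective.over X ⊞ L ⟶ Projective.over Y :=
      biprod.desc l (Projective.π (kernel q) ≫ kernel.ι q)
    let I : FP C := ⟨cokernel (preadditiveCoyoneda.map φ.op),
      _, _, trivial, trivial, _, ⟨Iso.refl _⟩⟩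
    have hIa : I.obj.Additive := ((isFP_iff _).1 I.property).1
    obtain ⟨e, he⟩ : ∃ e, Presents I.obj φ e := presents_cokernel _ φ (Category.comp_id φ)
    let p' : Projective.over X ⊞ L ⟶ X := biprod.desc (Projective.π X) 0
    have hp' : p' ≫ f = φ ≫ q := by
      apply biprod.hom_ext' <;> simp [p', φ, hl]
    obtain ⟨α, hα⟩ := hx.exists_hom (I.obj.map p' e) (by
      rw [← map_comp_apply', he.rel]; exact ⟨q, hp'.symm⟩)
    have hinj : ∀ A, Function.Injective (α.app A) := by
      intro A
      rw [injective_iff_map_eq_zero]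
      intro z hz
      obtain ⟨h, rfl⟩ := hx.gen A z
      rw [nat_apply, hα, ← map_comp_apply', he.rel] at hz
      obtain ⟨k, hk⟩ := hz
      have hk1 : l ≫ k = Projective.π X ≫ h := by
        have := biprod.inl ≫= hk
        simpa [φ, p'] using this
      have hk2 : kernel.ι q ≫ k = 0 := by
        have := biprod.inr ≫= hk
        simp only [φ, p', biprod.inr_desc_assoc, Category.assoc, zero_comp] at this
        rwa [← cancel_epi (Projective.π (kernel q)), comp_zero]
      have hex : (ShortComplex.mk (kernel.ι q) q (kernel.condition q)).Exact :=
        ShortComplex.exact_kernel q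
      have : Epi (ShortComplex.mk (kernel.ι q) q (kernel.condition q)).g :=
        inferInstanceAs (Epi q)
      obtain ⟨t, ht⟩ : ∃ t, q ≫ t = k := ⟨_, hex.g_desc k hk2⟩
      rw [hx.rel]
      refine ⟨t, ?_⟩
      rw [← cancel_epi (Projective.π X), ← hk1, ← Category.assoc, ← hl, Category.assoc, ht]
    have hmono : Mono α := by
      have : ∀ A, Mono (α.app A) := fun A => (AddCommGrpCat.mono_iff_injective _).2 (hinj A)
      exact NatTrans.mono_of_mono_app α
    exact ⟨I, injective_of_presents I he, ObjectProperty.homMk α,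
      (isFP (C := C)).ι.mono_of_mono_map hmono⟩

/-- The contravariant Yoneda embedding `X ↦ (X, -)` of `C` into `fp(C, Ab)`. -/
def repFP : Cᵒᵖ ⥤ FP C := (isFP (C := C)).lift preadditiveCoyoneda fun X => isFP_rep X.unop

instance : (repFP (C := C)).Additive where
  map_add {X Y f g} := by
    ext1
    ext A h
    exact Preadditive.add_comp _ _ _ f.unop g.unop h

end FinitelyPresented

/-- Exactness of `F ⟶ G ⟶ H` at `G`, evaluated at every object. -/
def ExactSeq {C : Type*} [Category* C] {F G H : C ⥤ AddCommGrpCat.{v}} (α : F ⟶ G)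
    (β : G ⟶ H) : Prop :=
  ∀ A : C, Function.Exact (α.app A) (β.app A)

section Modules

variable (S : Type u) [Ring S]

/-- The property of being a finitely presented module. -/
def isFPModule : ObjectProperty (ModuleCat.{u} S) := fun M => Module.FinitePresentation S M

/-- The category of finitely presented `S`-modules. -/
abbrev FPMod := (isFPModule S).FullSubcategory

/-- Totally finitely presented functors: those with a presentation
`(Y, -) ⟶ (X, -) ⟶ F ⟶ 0` by finitely presented modules `X` and `Y`. -/
abbrev isTFP : ObjectProperty (ModuleCat.{u} S ⥤ AddCommGrpCat.{u}) :=
  HasPresentation (isFPModule S)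

/-- The category `tfp(Mod, Ab)` of totally finitely presented functors. -/
abbrev TFP := (isTFP S).FullSubcategory

lemma isTFP_le_isFP : isTFP S ≤ isFP := by
  rintro F ⟨X, Y, -, -, α, e⟩
  exact ⟨X, Y, trivial, trivial, α, e⟩

/-- The inclusion of `tfp(Mod, Ab)` in `fp(Mod, Ab)`. -/
abbrev tfpToFP : TFP S ⥤ FP (ModuleCat.{u} S) := ObjectProperty.ιOfLE (isTFP_le_isFP S)

/-- The contravariant embedding `X ↦ (X, -)` of finitely presented modules in `tfp(Mod, Ab)`. -/
def repTFP : (FPMod S)ᵒᵖ ⥤ TFP S :=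
  (isTFP S).lift ((isFPModule S).ι.op ⋙ preadditiveCoyoneda) fun X =>
    (rep_presents_id X.unop.obj).hasPresentation (F := rep X.unop.obj) X.unop.property X.unop.property

end Modules

section Duality

variable (R : Type u) [Ring R]

/-- A ring is coherent if the categories of finitely presented left modules and of finitely
presented right modules are abelian. -/
def IsCoherentRing : Prop :=
  Nonempty (Abelian (FPMod R)) ∧ Nonempty (Abelian (FPMod Rᵐᵒᵖ))

/-- The category of right `R`-modules. -/
abbrev RightMod := ModuleCat.{u} Rᵐᵒᵖ

/-- The category of left `R`-modules, that is, of right modules over the opposite ring. -/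
abbrev LeftMod := ModuleCat.{u} R

/-- The ring as a right module over itself. -/
abbrev regular : RightMod R := ModuleCat.of Rᵐᵒᵖ R

variable {R} in
/-- Left multiplication by `r`, an endomorphism of the right module `R`. -/
def leftMul (r : R) : regular R ⟶ regular R :=
  ModuleCat.ofHom
    { toFun := fun x => r * x
      map_add' := fun x y => mul_add r x y
      map_smul' := fun s x => (mul_assoc r x s.unop).symm }

variable {R} in
/-- The ring homomorphism `r ↦ F(r · -)` from `R` to the endomorphisms of the group `F(R)`. -/
def evalAction (F : RightMod R ⥤ AddCommGrpCat.{u}) [F.Additive] :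
    R →+* AddMonoid.End (F.obj (regular R)) where
  toFun r := (F.map (leftMul r)).hom
  map_one' := by
    have : leftMul (1 : R) = 𝟙 _ :=
      ModuleCat.hom_ext (LinearMap.ext fun x => one_mul x)
    rw [this, F.map_id]; rfl
  map_mul' r s := by
    have : leftMul (r * s) = leftMul s ≫ leftMul r :=
      ModuleCat.hom_ext (LinearMap.ext fun x => mul_assoc r s x)
    rw [this, F.map_comp]; rfl
  map_zero' := by
    have : leftMul (0 : R) = 0 :=
      ModuleCat.hom_ext (LinearMap.ext fun x => zero_mul x)
    rw [this, F.map_zero]; rfl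
  map_add' r s := by
    have : leftMul (r + s) = leftMul r + leftMul s :=
      ModuleCat.hom_ext (LinearMap.ext fun x => add_mul r s x)
    rw [this, F.map_add]; rfl

variable {R} in
lemma additive_of_isFP {F : RightMod R ⥤ AddCommGrpCat.{u}} (hF : isFP F) : F.Additive :=
  ((isFP_iff F).1 hF).1

variable {R} in
/-- The left `R`-module `F(R)`, with `r` acting by `F(r · -)`. -/
def evalRing (F : FP (RightMod R)) : LeftMod R :=
  letI := additive_of_isFP F.property
  letI : Module R (F.obj.obj (regular R)) := Module.compHom _ (evalAction F.obj)
  ModuleCat.of R (F.obj.obj (regular R))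

/-- Evaluation at the ring, `F ↦ F(R)`. -/
def ev : FP (RightMod R) ⥤ LeftMod R where
  obj F := evalRing F
  map {F G} α := ModuleCat.ofHom (X := evalRing F) (Y := evalRing G)
    { toFun := fun x => α.hom.app (regular R) x
      map_add' := fun x y => map_add (α.hom.app (regular R)).hom x y
      map_smul' := fun r x => nat_apply α.hom (leftMul r) x }

instance : (ev R).Additive where

/-- The contravariant functor `Y_R`, `F ↦ (F(R), -)`. -/
def yonedaEv : (FP (RightMod R))ᵒᵖ ⥤ FP (LeftMod R) := (ev R).op ⋙ repFP

instance : (yonedaEv R).Additive := inferInstanceAs ((ev R).op ⋙ repFP).Additive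

/-- The contravariant functor `D_R`: the zeroth left derived functor of `Y_R`. As `Y_R` is
contravariant, it is computed by injective resolutions in `fp(Mod(R), Ab)`, which are the
projective resolutions in the opposite category. -/
def dualFunctor : (FP (RightMod R))ᵒᵖ ⥤ FP (LeftMod R) := (yonedaEv R).leftDerived 0

variable {R}

open scoped TensorProduct

/-- The relations `m r ⊗ a = m ⊗ r a` in `M ⊗_ℤ A`. -/
def balanced (M : RightMod R) (A : LeftMod R) : AddSubgroup (M ⊗[ℤ] A) :=
  AddSubgroup.closure
    {t | ∃ (m : M) (r : R) (a : A), t = (MulOpposite.op r • m) ⊗ₜ[ℤ] a - m ⊗ₜ[ℤ] (r • a)}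

/-- The tensor product `M ⊗_R A` of a right module and a left module. -/
abbrev Tensor (M : RightMod R) (A : LeftMod R) : Type u := (M ⊗[ℤ] A) ⧸ balanced M A

/-- The element `m ⊗ a` of `M ⊗_R A`. -/
def tmul {M : RightMod R} {A : LeftMod R} (m : M) (a : A) : Tensor M A :=
  QuotientAddGroup.mk (m ⊗ₜ[ℤ] a)

lemma tensor_hom_ext {M : RightMod R} {A : LeftMod R} {B : Type*} [AddCommGroup B]
    {f g : Tensor M A →+ B} (h : ∀ m a, f (tmul m a) = g (tmul m a)) : f = g := by
  apply QuotientAddGroup.addMonoidHom_ext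
  ext t
  induction t using TensorProduct.induction_on with
  | zero => simp
  | tmul m a => exact h m a
  | add x y hx hy => rw [map_add, map_add, hx, hy]

/-- The map `f ⊗ g` on tensor products over `R`. -/
def tensorMap {M M' : RightMod R} {A A' : LeftMod R} (f : M ⟶ M') (g : A ⟶ A') :
    Tensor M A →+ Tensor M' A' :=
  QuotientAddGroup.map _ _
    (TensorProduct.map f.hom.toAddMonoidHom.toIntLinearMap
      g.hom.toAddMonoidHom.toIntLinearMap).toAddMonoidHom <| by
    refine (AddSubgroup.closure_le _).2 ?_
    rintro _ ⟨m, r, a, rfl⟩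
    refine AddSubgroup.subset_closure ⟨f.hom m, r, g.hom a, ?_⟩
    simp

@[simp]
lemma tensorMap_tmul {M M' : RightMod R} {A A' : LeftMod R} (f : M ⟶ M') (g : A ⟶ A')
    (m : M) (a : A) : tensorMap f g (tmul m a) = tmul (f m) (g a) := rfl

variable (R) in
/-- The functor `A ↦ (- ⊗ A)`; its flip is `M ↦ (M ⊗ -)`. -/
def tensor : LeftMod R ⥤ RightMod R ⥤ AddCommGrpCat.{u} where
  obj A :=
    { obj := fun M => AddCommGrpCat.of (Tensor M A)
      map := fun f => AddCommGrpCat.ofHom (tensorMap f (𝟙 A))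
      map_id := fun _ => AddCommGrpCat.hom_ext (tensor_hom_ext fun _ _ => rfl)
      map_comp := fun _ _ => AddCommGrpCat.hom_ext (tensor_hom_ext fun _ _ => rfl) }
  map g :=
    { app := fun M => AddCommGrpCat.ofHom (tensorMap (𝟙 M) g)
      naturality := fun _ _ _ => AddCommGrpCat.hom_ext (tensor_hom_ext fun _ _ => rfl) }
  map_id _ := by ext M : 2; exact AddCommGrpCat.hom_ext (tensor_hom_ext fun _ _ => rfl)
  map_comp _ _ := by ext M : 2; exact AddCommGrpCat.hom_ext (tensor_hom_ext fun _ _ => rfl)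

end Duality

section PositivePrimitive

/-- A positive primitive formula in `n` free variables for left `S`-modules:
`∃ y, ∀ j, ∑ i, free j i • x i + ∑ l, bound j l • y l = 0`. -/
structure PPFormula (S : Type u) (n : ℕ) where
  /-- the number of bound variables -/
  numVars : ℕ
  /-- the number of equations -/
  numEqs : ℕ
  /-- the coefficients of the free variables -/
  free : Fin numEqs → Fin n → S
  /-- the coefficients of the bound variables -/
  bound : Fin numEqs → Fin numVars → S

variable {S : Type u} [Ring S] {n : ℕ}

/-- The solutions of a positive primitive formula in a module. -/
def PPFormula.sol (φ : PPFormula S n) (M : ModuleCat.{u} S) : AddSubgroup (Fin n → M) where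
  carrier := {x | ∃ y : Fin φ.numVars → M,
    ∀ j, ∑ i, φ.free j i • x i + ∑ l, φ.bound j l • y l = 0}
  zero_mem' := ⟨0, by simp⟩
  add_mem' := by
    rintro x x' ⟨y, hy⟩ ⟨y', hy'⟩
    refine ⟨y + y', fun j => ?_⟩
    have := congrArg₂ (· + ·) (hy j) (hy' j)
    simp only [add_zero] at this
    simp only [Pi.add_apply, smul_add, Finset.sum_add_distrib]
    rw [← this]
    abel
  neg_mem' := by
    rintro x ⟨y, hy⟩
    refine ⟨-y, fun j => ?_⟩
    have := congrArg (- ·) (hy j)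
    simp only [neg_zero] at this
    simp only [Pi.neg_apply, smul_neg, Finset.sum_neg_distrib]
    rw [← this]
    abel

/-- A homomorphism of modules carries solutions to solutions. -/
def PPFormula.solMap (φ : PPFormula S n) {M M' : ModuleCat.{u} S} (f : M ⟶ M') :
    φ.sol M →+ φ.sol M' where
  toFun x := ⟨fun i => f (x.1 i), by
    obtain ⟨y, hy⟩ := x.2
    refine ⟨fun l => f (y l), fun j => ?_⟩
    have := congrArg f.hom (hy j)
    simpa using this⟩
  map_zero' := by ext i; simp
  map_add' x y := by ext i; simp

/-- The functor `M ↦ φ(M) / ψ(M)` of a pair of positive primitive formulas with `ψ ≤ φ`. -/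
def ppPair (φ ψ : PPFormula S n) : ModuleCat.{u} S ⥤ AddCommGrpCat.{u} where
  obj M := AddCommGrpCat.of (φ.sol M ⧸ (ψ.sol M).addSubgroupOf (φ.sol M))
  map f := AddCommGrpCat.ofHom <| QuotientAddGroup.map _ _ (φ.solMap f) fun x hx =>
    (ψ.solMap f ⟨x.1, hx⟩).2
  map_id M := by ext x; rfl
  map_comp f g := by ext x; rfl

/-- The dual of a formula for right modules, a formula for left modules: the dual of
`∃ y, x A + y B = 0` is `∃ z, x + A z = 0 ∧ B z = 0`. -/
def PPFormula.dual {R : Type u} [Ring R] (φ : PPFormula Rᵐᵒᵖ n) : PPFormula R n where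
  numVars := φ.numEqs
  numEqs := n + φ.numVars
  free := Fin.append (fun i i' => if i = i' then 1 else 0) (fun _ _ => 0)
  bound := Fin.append (fun i j => (φ.free j i).unop) (fun l j => (φ.bound j l).unop)

lemma PPFormula.mem_dual_sol {R : Type u} [Ring R] (φ : PPFormula Rᵐᵒᵖ n) (N : ModuleCat.{u} R)
    (x : Fin n → N) : x ∈ φ.dual.sol N ↔ ∃ z : Fin φ.numEqs → N,
      (∀ i, x i + ∑ j, (φ.free j i).unop • z j = 0) ∧
      ∀ l, ∑ j, (φ.bound j l).unop • z j = 0 := by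
  refine exists_congr fun z => ?_
  refine (Fin.forall_fin_add _).trans ?_
  simp [PPFormula.dual, ite_smul]
  exact Iff.rfl

end PositivePrimitive

end

end FunctorDuality

open FunctorDuality

/-! The functors `- ⊗ A` with `A` finitely presented serve as injectives. Reading a presentation `Rᵐ
→ Rⁿ → A → 0` backwards presents `- ⊗ A` by a map between free modules of finite rank
(`exists_presents_tensor`). Hence `- ⊗ A` is totally finitely presented and injective among finitely
presented functors. Evaluation at the regular module shows that `A ↦ - ⊗ A` is fully faithful and
recovers `A`.

Every totally finitely presented `F` is the kernel of some `- ⊗ k` with `k : A ⟶ B` between finitely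
presented modules. Indeed `F` is given by a pair `φ / ψ`, and pairing with the generic solution of
the dual of `ψ` embeds it in some `- ⊗ A` (`exists_pairingHom_injective`); the cokernel embeds in
the same way. The sequence `0 → F → - ⊗ A → - ⊗ B` starts an injective resolution, and evaluation at
`R` turns it into `k`. So the derived functor at `F` is the cokernel of `(B, -) → (A, -)`
(`Copresentation.presents`).

The functor `C ↦ Nat(F, - ⊗ C)` is presented by the same `k` (`RepresentsDual.presents`). For
arbitrary `C` the functor `- ⊗ C` need not be finitely presented, but it is right exact, and this is
enough for extending maps between finitely presented functors (`Presents.exists_extension`). Thus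
maps `F ⟶ - ⊗ C` come from maps `A ⟶ C`, modulo those that factor through `k`. Comparing the two
presentations gives `DF(C) ≅ Nat(F, - ⊗ C)`, and lifting maps to resolutions gives naturality in `F`
(`exists_map_elt`).

The rest is read off from `Nat(F, - ⊗ C)`. Exactness is the extension property once more.
Equivalence holds because the kernel of `- ⊗ k` and the cokernel of `(k, -)` determine each other.
Yoneda gives the value at `(X, -)`. For pairs of formulas, the dual of `φ` consists of the tuples
orthogonal to `φ` (`mem_dual_sol_iff`), and every map `φ / ψ ⟶ - ⊗ N` is a pairing. Uniqueness holds
because an exact contravariant functor is determined, via kernels, by its values on representables.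
-/

namespace FunctorDuality

noncomputable section

/-! ### Presentations of functors and extension of maps into right exact functors. -/

section Presentations

variable {C : Type u} [Category.{v} C] [Abelian C]

/-- `F` carries right exact sequences to exact sequences. -/
def IsRightExact (F : C ⥤ AddCommGrpCat.{v}) : Prop :=
  ∀ ⦃U V : C⦄ (a : U ⟶ V) (v : F.obj V), F.map (cokernel.π a) v = 0 → ∃ u : F.obj U, F.map a u = v

lemma Presents.map_eq_zero {F : C ⥤ AddCommGrpCat.{v}} {X Y : C} {f : X ⟶ Y} {x : F.obj X}
    (h : Presents F f x) : F.map f x = 0 :=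
  (h.rel _ f).2 ⟨𝟙 _, Category.comp_id f⟩

/-- Right exact functors are injective relative to finitely presented functors. -/
lemma Presents.exists_extension {F G I : C ⥤ AddCommGrpCat.{v}} [G.Additive] [I.Additive]
    {X₀ X₁ Y₀ Y₁ : C} {f : X₀ ⟶ X₁} {a : F.obj X₀} {g : Y₀ ⟶ Y₁} {b : G.obj Y₀}
    (ha : Presents F f a) (hb : Presents G g b) (hI : IsRightExact I) (m : F ⟶ G) (φ : F ⟶ I)
    (hφ : ∀ A z, m.app A z = 0 → φ.app A z = 0) : ∃ ψ : G ⟶ I, m ≫ ψ = φ := by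
  obtain ⟨c, hc⟩ := hb.gen X₀ (m.app X₀ a)
  -- The cokernel of `w` is the pushout of `c` and `g`. There the image of `m(a)` becomes a multiple
  -- of the relation `g` on `b`, so it vanishes, and with it the image of `φ(a)`.
  let w : Y₀ ⟶ X₀ ⊞ Y₁ := biprod.lift c (-g)
  have hw : c ≫ biprod.inl ≫ cokernel.π w = g ≫ biprod.inr ≫ cokernel.π w := by
    have := cokernel.condition w
    rw [← sub_eq_zero, ← this]
    simp only [w, biprod.lift_eq, Preadditive.add_comp, Preadditive.neg_comp, Category.assoc]
    abel
  have h0 : φ.app _ (F.map (biprod.inl ≫ cokernel.π w) a) = 0 := by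
    apply hφ
    rw [nat_apply, ← hc, ← map_comp_apply', hw, map_comp_apply', hb.map_eq_zero, map_zero]
  -- An extension is an element `j` with `I(c) j = φ(a)` and `I(g) j = 0`, that is, a preimage of
  -- `(φ(a), 0)` under `I(w)`.
  obtain ⟨j, hj⟩ := hI w (I.map biprod.inl (φ.app X₀ a)) (by
    rw [← map_comp_apply', ← nat_apply, h0])
  have hj1 := congrArg (I.map biprod.fst) hj
  have hj2 := congrArg (I.map biprod.snd) hj
  rw [← map_comp_apply', ← map_comp_apply', biprod.lift_fst, biprod.inl_fst,
    map_id_apply'] at hj1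
  rw [← map_comp_apply', ← map_comp_apply', biprod.lift_snd, biprod.inl_snd,
    map_zero_apply, map_neg_apply, neg_eq_zero] at hj2
  obtain ⟨ψ, hψ⟩ := hb.exists_hom j hj2
  refine ⟨ψ, ha.hom_ext ?_⟩
  change ψ.app X₀ (m.app X₀ a) = _
  rw [← hc, nat_apply, hψ, hj1]

/-- Each functor receives a map from the other because the two generators satisfy the same
relations. All comparisons of duals below rest on this. -/
lemma Presents.exists_iso {F G : C ⥤ AddCommGrpCat.{v}} [F.Additive] [G.Additive] {X Y : C}
    {f : X ⟶ Y} {x : F.obj X} {y : G.obj X} (hx : Presents F f x) (hy : Presents G f y) :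
    ∃ e : F ≅ G, e.hom.app X x = y := by
  obtain ⟨a, ha⟩ := hx.exists_hom y hy.map_eq_zero
  obtain ⟨b, hb⟩ := hy.exists_hom x hx.map_eq_zero
  refine ⟨⟨a, b, hx.hom_ext ?_, hy.hom_ext ?_⟩, ha⟩
  · change b.app X (a.app X x) = x
    rw [ha, hb]
  · change a.app X (b.app X y) = y
    rw [hb, ha]

/-- A presentation may be replaced by an isomorphic one. -/
lemma Presents.congr_iso {F : C ⥤ AddCommGrpCat.{v}} {X Y X' Y' : C}
    {f : X ⟶ Y} {x : F.obj X} (h : Presents F f x) (p : X ≅ X') (q : Y ≅ Y') {f' : X' ⟶ Y'}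
    (w : f ≫ q.hom = p.hom ≫ f') : Presents F f' (F.map p.hom x) where
  gen A z := by
    obtain ⟨k, hk⟩ := h.gen A z
    exact ⟨p.inv ≫ k, by rw [← map_comp_apply', p.hom_inv_id_assoc, hk]⟩
  rel A k := by
    rw [← map_comp_apply', h.rel]
    constructor
    · rintro ⟨l, hl⟩
      refine ⟨q.inv ≫ l, ?_⟩
      rw [← cancel_epi p.hom, ← reassoc_of% w, q.hom_inv_id_assoc, hl]
    · rintro ⟨l, rfl⟩
      exact ⟨q.hom ≫ l, by rw [reassoc_of% w]⟩

/-- The kernel of a map of presented functors is presented by a pushout. -/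
lemma Presents.exists_presents_kernel {K F G : C ⥤ AddCommGrpCat.{v}} [G.Additive]
    {X₀ X₁ Y₀ Y₁ : C} {f : X₀ ⟶ X₁} {x : F.obj X₀} {g : Y₀ ⟶ Y₁} {y : G.obj Y₀}
    (hx : Presents F f x) (hy : Presents G g y) (i : K ⟶ F) (α : F ⟶ G)
    (hinj : ∀ A, Function.Injective (i.app A)) (hex : ExactSeq i α) :
    ∃ (a : Y₀ ⟶ X₀) (q : K.obj (pushout a g)),
      Presents K (pushout.inl (pushout.inl a g) f) q := by
  obtain ⟨a, ha⟩ := hy.gen X₀ (α.app X₀ x)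
  -- A map `h` out of `X₀` yields an element of the kernel exactly when `a ≫ h` factors through `g`,
  -- that is, when `h` extends over this pushout.
  let Q := pushout a g
  have hq : α.app Q (F.map (pushout.inl a g) x) = 0 := by
    rw [nat_apply, ← ha, ← map_comp_apply', pushout.condition, map_comp_apply',
      hy.map_eq_zero, map_zero]
  obtain ⟨q, hq⟩ := (hex Q _).1 hq
  refine ⟨a, q, ?_, ?_⟩
  · intro A z
    obtain ⟨h, hh⟩ := hx.gen A (i.app A z)
    have h0 : G.map (a ≫ h) y = 0 := by
      rw [map_comp_apply', ha, ← nat_apply, hh]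
      exact (hex A _).2 ⟨z, rfl⟩
    obtain ⟨l, hl⟩ := (hy.rel _ _).1 h0
    refine ⟨pushout.desc h l hl.symm, hinj A ?_⟩
    rw [nat_apply, hq, ← map_comp_apply', pushout.inl_desc, hh]
  · intro A t
    have h1 : K.map t q = 0 ↔ F.map (pushout.inl a g ≫ t) x = 0 := by
      rw [map_comp_apply', ← hq, ← nat_apply]
      exact ⟨fun h => by rw [h, map_zero], fun h => hinj A (by rw [h, map_zero])⟩
    rw [h1, hx.rel]
    constructor
    · rintro ⟨l, hl⟩
      exact ⟨pushout.desc t l hl.symm, pushout.inl_desc _ _ _⟩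
    · rintro ⟨l, rfl⟩
      refine ⟨pushout.inr _ _ ≫ l, ?_⟩
      rw [← Category.assoc, ← pushout.condition, Category.assoc]

/-- The cokernel of a map of presented functors is presented by a biproduct. -/
lemma Presents.exists_presents_cokernel {K F G : C ⥤ AddCommGrpCat.{v}} [G.Additive]
    {X₀ X₁ Y₀ Y₁ : C} {f : X₀ ⟶ X₁} {x : F.obj X₀} {g : Y₀ ⟶ Y₁} {y : G.obj Y₀}
    (hx : Presents F f x) (hy : Presents G g y) (α : F ⟶ G) (p : G ⟶ K)
    (hsurj : ∀ A, Function.Surjective (p.app A)) (hex : ExactSeq α p) :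
    ∃ a : Y₀ ⟶ X₀, Presents K (biprod.lift g a) (p.app Y₀ y) := by
  obtain ⟨a, ha⟩ := hy.gen X₀ (α.app X₀ x)
  refine ⟨a, ?_, ?_⟩
  · intro A z
    obtain ⟨w, rfl⟩ := hsurj A z
    obtain ⟨h, rfl⟩ := hy.gen A w
    exact ⟨h, (nat_apply _ _ _).symm⟩
  · intro A h
    rw [← nat_apply]
    refine (hex A _).trans ?_
    constructor
    · rintro ⟨w, hw⟩
      obtain ⟨l, rfl⟩ := hx.gen A w
      have : G.map (h - a ≫ l) y = 0 := by
        rw [map_sub_apply, map_comp_apply', ha, ← nat_apply, sub_eq_zero]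
        exact hw.symm
      obtain ⟨m, hm⟩ := (hy.rel _ _).1 this
      exact ⟨biprod.desc m l, by simp [hm]⟩
    · rintro ⟨m, rfl⟩
      refine ⟨F.map (biprod.inr ≫ m) x, ?_⟩
      have : biprod.lift g a ≫ m = g ≫ (biprod.inl ≫ m) + a ≫ (biprod.inr ≫ m) := by
        rw [biprod.lift_eq]; simp
      rw [this, map_add_apply, map_comp_apply' G g, hy.map_eq_zero, map_zero, zero_add, nat_apply,
        map_comp_apply' G a, ha]

lemma rep_hom_apply {F : C ⥤ AddCommGrpCat.{v}} {X A : C} (π : rep X ⟶ F) (h : X ⟶ A) :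
    π.app A h = F.map h (π.app X (𝟙 X : X ⟶ X)) := by
  refine Eq.trans ?_ (nat_apply π h (𝟙 X : X ⟶ X))
  congr 1
  exact (Category.id_comp h).symm

/-- An exact sequence `(Y, -) ⟶ (X, -) ⟶ F ⟶ 0` is a presentation. -/
lemma presents_of_exactSeq {F : C ⥤ AddCommGrpCat.{v}} {X Y : C} (f : X ⟶ Y) (π : rep X ⟶ F)
    (hex : ExactSeq (preadditiveCoyoneda.map f.op) π)
    (hsurj : ∀ A, Function.Surjective (π.app A)) :
    Presents F f (π.app X (𝟙 X : X ⟶ X)) where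
  gen A z := by
    obtain ⟨h, rfl⟩ := hsurj A z
    exact ⟨h, (rep_hom_apply π h).symm⟩
  rel A h := by
    rw [← rep_hom_apply]
    exact hex A h

lemma Presents.exists_rep_hom {F : C ⥤ AddCommGrpCat.{v}} [F.Additive] {X Y : C} {f : X ⟶ Y}
    {x : F.obj X} (h : Presents F f x) : ∃ π : rep X ⟶ F, π.app X (𝟙 X : X ⟶ X) = x ∧
      ExactSeq (preadditiveCoyoneda.map f.op) π ∧ ∀ A, Function.Surjective (π.app A) := by
  obtain ⟨π, hπ⟩ := (rep_presents_id X).exists_hom (G := F) x (map_zero_apply F x)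
  refine ⟨π, hπ, fun A k => ?_, fun A z => ?_⟩
  · have e : π.app A k = F.map k x := (rep_hom_apply π k).trans (by rw [hπ])
    exact (Iff.of_eq (congrArg (· = 0) e)).trans (h.rel A k)
  · obtain ⟨k, rfl⟩ := h.gen A z
    exact ⟨k, (rep_hom_apply π k).trans (by rw [hπ])⟩

end Presentations

/-! ### Modules given by finite matrices of relations. -/

section GeneratorsAndRelations

variable {S : Type u} [Ring S] {ι κ : Type} [Fintype ι] [Fintype κ]

/-- The module `M` is generated by `g`, and the relations of `g` are generated by the rows
of the matrix `rel`. -/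
structure IsPresentedBy (M : ModuleCat.{u} S) (rel : κ → ι → S) (g : ι → M) : Prop where
  span : ∀ m : M, ∃ c : ι → S, ∑ i, c i • g i = m
  rel_iff : ∀ c : ι → S, ∑ i, c i • g i = 0 ↔ ∃ d : κ → S, ∀ i, ∑ j, d j * rel j i = c i

lemma mem_span_rows_iff (rel : κ → ι → S) (c : ι → S) :
    c ∈ Submodule.span S (Set.range rel) ↔ ∃ d : κ → S, ∀ i, ∑ j, d j * rel j i = c i := by
  rw [Submodule.mem_span_range_iff_exists_fun]
  simp [funext_iff]

lemma exists_isPresentedBy (rel : κ → ι → S) :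
    ∃ (M : ModuleCat.{u} S) (g : ι → M), IsPresentedBy M rel g := by
  classical
  let K := Submodule.span S (Set.range rel)
  have key : ∀ c : ι → S, ∑ i, c i • K.mkQ (Pi.single i 1) = K.mkQ c := by
    intro c
    conv_rhs => rw [pi_eq_sum_univ' c]
    simp
  refine ⟨ModuleCat.of S ((ι → S) ⧸ K), fun i => K.mkQ (Pi.single i 1), fun m => ?_, fun c => ?_⟩
  · obtain ⟨c, rfl⟩ := K.mkQ_surjective m
    exact ⟨c, key c⟩
  · rw [← mem_span_rows_iff, ← Submodule.Quotient.mk_eq_zero, ← Submodule.mkQ_apply, ← key c]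

lemma IsPresentedBy.isFPModule {M : ModuleCat.{u} S} {rel : κ → ι → S} {g : ι → M}
    (h : IsPresentedBy M rel g) : isFPModule S M := by
  refine Module.finitePresentation_of_free_of_surjective (Fintype.linearCombination S g) ?_ ?_
  · intro m
    obtain ⟨c, rfl⟩ := h.span m
    exact ⟨c, Fintype.linearCombination_apply S g c⟩
  · have : LinearMap.ker (Fintype.linearCombination S g) = Submodule.span S (Set.range rel) := by
      ext c
      rw [LinearMap.mem_ker, Fintype.linearCombination_apply, h.rel_iff, mem_span_rows_iff]
    rw [this]
    exact Submodule.fg_span (Set.finite_range rel)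

lemma exists_isPresentedBy_of_isFPModule {M : ModuleCat.{u} S} (hM : isFPModule S M) :
    ∃ (n m : ℕ) (rel : Fin m → Fin n → S) (g : Fin n → M), IsPresentedBy M rel g := by
  have : Module.FinitePresentation S M := hM
  obtain ⟨n, m, f, r, hf, hex⟩ := Module.FinitePresentation.exists_fin' S M
  have hf' : ∀ c : Fin n → S, ∑ i, c i • f (Pi.single i 1) = f c := by
    intro c
    conv_rhs => rw [pi_eq_sum_univ' c]
    simp
  refine ⟨n, m, fun j => r (Pi.single j 1), fun i => f (Pi.single i 1), fun x => ?_, fun c => ?_⟩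
  · obtain ⟨c, rfl⟩ := hf x
    exact ⟨c, hf' c⟩
  · rw [hf', hex c]
    refine exists_congr fun d => ?_
    conv_lhs => rw [pi_eq_sum_univ' d]
    simp [funext_iff]

namespace IsPresentedBy

variable {M : ModuleCat.{u} S} {rel : κ → ι → S} {g : ι → M}

lemma sum_rel (h : IsPresentedBy M rel g) (j : κ) : ∑ i, rel j i • g i = 0 := by
  classical
  exact (h.rel_iff _).2 ⟨Pi.single j 1, fun i => by simp [Pi.single_apply]⟩

/-- Solutions of a linear system in `N` are the same as maps into `N` from the module the system
presents; this is the bridge between formulas and representable functors. -/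
lemma exists_hom (h : IsPresentedBy M rel g) {N : ModuleCat.{u} S} (x : ι → N)
    (hx : ∀ j, ∑ i, rel j i • x i = 0) : ∃ f : M ⟶ N, ∀ i, f (g i) = x i := by
  classical
  choose s hs using h.span
  have key : ∀ c c' : ι → S, ∑ i, c i • g i = ∑ i, c' i • g i →
      ∑ i, c i • x i = ∑ i, c' i • x i := by
    intro c c' e
    obtain ⟨d, hd⟩ := (h.rel_iff (c - c')).1 (by simp [sub_smul, e])
    rw [← sub_eq_zero, ← Finset.sum_sub_distrib]
    simp only [← sub_smul]
    calc ∑ i, (c i - c' i) • x i = ∑ i, ∑ j, (d j * rel j i) • x i := by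
          simp only [← Finset.sum_smul, hd, Pi.sub_apply]
      _ = ∑ j, d j • ∑ i, rel j i • x i := by
          rw [Finset.sum_comm]; simp only [Finset.smul_sum, mul_smul]
      _ = 0 := by simp [hx]
  refine ⟨ModuleCat.ofHom { toFun := fun m => ∑ i, s m i • x i, map_add' := fun m m' => ?_,
                            map_smul' := fun r m => ?_ }, fun i => ?_⟩
  · refine (key _ (s m + s m') ?_).trans ?_
    · simp [add_smul, Finset.sum_add_distrib, hs]
    · simp [add_smul, Finset.sum_add_distrib]
  · refine (key _ (r • s m) ?_).trans ?_
    · simp [mul_smul, ← Finset.smul_sum, hs]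
    · simp [mul_smul, ← Finset.smul_sum]
  · refine (key _ (Pi.single i 1) ?_).trans ?_
    · rw [hs]; simp [Pi.single_apply]
    · simp [Pi.single_apply]

lemma hom_ext (h : IsPresentedBy M rel g) {N : ModuleCat.{u} S} {f f' : M ⟶ N}
    (e : ∀ i, f (g i) = f' (g i)) : f = f' := by
  ext m
  obtain ⟨c, rfl⟩ := h.span m
  simp [e]

end IsPresentedBy

lemma isFPModule_of_surjective {M N : ModuleCat.{u} S} (hM : isFPModule S M) (f : M ⟶ N)
    (hf : Function.Surjective f) (hk : (LinearMap.ker f.hom).FG) : isFPModule S N := by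
  have : Module.FinitePresentation S M := hM
  exact Module.finitePresentation_of_surjective f.hom hf hk

lemma isFPModule_of_iso {M N : ModuleCat.{u} S} (e : M ≅ N) (hM : isFPModule S M) :
    isFPModule S N := by
  have : Module.FinitePresentation S M := hM
  exact Module.FinitePresentation.of_equiv e.toLinearEquiv

lemma isFPModule_biprod {M N : ModuleCat.{u} S} (hM : isFPModule S M) (hN : isFPModule S N) :
    isFPModule S (M ⊞ N) := by
  have : Module.FinitePresentation S M := hM
  have : Module.FinitePresentation S N := hN
  refine isFPModule_of_iso (ModuleCat.biprodIsoProd M N).symm ?_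
  exact inferInstanceAs (Module.FinitePresentation S (M × N))

lemma isFPModule_cokernel {M N : ModuleCat.{u} S} (hM : isFPModule S M) (hN : isFPModule S N)
    (f : M ⟶ N) : isFPModule S (cokernel f) := by
  have : Module.FinitePresentation S M := hM
  refine isFPModule_of_surjective hN (cokernel.π f)
    ((ModuleCat.epi_iff_surjective _).1 inferInstance) ?_
  have := (ShortComplex.moduleCat_exact_iff_range_eq_ker _).1 (ShortComplex.exact_cokernel f)
  dsimp at this
  rw [← this, LinearMap.range_eq_map]
  exact Module.Finite.fg_top.map _

/-- A pushout is the cokernel of a map into a biproduct, and both constructions preserve finite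
presentation. -/
lemma isFPModule_pushout {M N P : ModuleCat.{u} S} (hM : isFPModule S M) (hN : isFPModule S N)
    (hP : isFPModule S P) (f : M ⟶ N) (g : M ⟶ P) : isFPModule S (pushout f g) := by
  refine isFPModule_of_iso ?_ (isFPModule_cokernel hM (isFPModule_biprod hN hP)
    (biprod.lift f (-g)))
  exact (cokernelIsCokernel _).coconePointUniqueUpToIso
    (IsPushout.of_hasPushout f g).isColimitCokernelCofork

end GeneratorsAndRelations

/-! ### Tensor products over `R` as functors: elements, right exactness, full faithfulness. -/

section TensorProducts

open scoped TensorProduct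

variable {R : Type u} [Ring R]

section Elements

variable {M : RightMod R} {A : LeftMod R}

variable (M A) in
/-- The group `M ⊗ A`, as a value of the functor `- ⊗ A`. -/
abbrev TensorObj : Type u := ((tensor R).obj A).obj M

/-- The element `m ⊗ a`, in the value at `M` of the functor `- ⊗ A`. -/
def tens (m : M) (a : A) : TensorObj M A := tmul m a

lemma add_tens (m m' : M) (a : A) : tens (m + m') a = tens m a + tens m' a :=
  congrArg (QuotientAddGroup.mk' (balanced M A)) (TensorProduct.add_tmul m m' a)

lemma tens_add (m : M) (a a' : A) : tens m (a + a') = tens m a + tens m a' :=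
  congrArg (QuotientAddGroup.mk' (balanced M A)) (TensorProduct.tmul_add m a a')

lemma op_smul_tens (r : R) (m : M) (a : A) : tens (MulOpposite.op r • m) a = tens m (r • a) :=
  (QuotientAddGroup.eq_iff_sub_mem).2 (AddSubgroup.subset_closure ⟨m, r, a, rfl⟩)

variable (M) in
/-- The map `m ↦ m ⊗ a`. -/
def tensLeft (a : A) : M →+ TensorObj M A := AddMonoidHom.mk' (fun m => tens m a) (add_tens · · a)

variable (A) in
/-- The map `a ↦ m ⊗ a`. -/
def tensRight (m : M) : A →+ TensorObj M A := AddMonoidHom.mk' (fun a => tens m a) (tens_add m)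

lemma sum_tens {ι : Type*} (s : Finset ι) (m : ι → M) (a : A) :
    tens (∑ i ∈ s, m i) a = ∑ i ∈ s, tens (m i) a := map_sum (tensLeft M a) m s

lemma tens_sum {ι : Type*} (s : Finset ι) (m : M) (a : ι → A) :
    tens m (∑ i ∈ s, a i) = ∑ i ∈ s, tens m (a i) := map_sum (tensRight A m) a s

lemma zero_tens (a : A) : tens (0 : M) a = 0 := map_zero (tensLeft M a)

lemma tens_zero (m : M) : tens m (0 : A) = 0 := map_zero (tensRight A m)

lemma neg_tens (m : M) (a : A) : tens (-m) a = - tens m a := map_neg (tensLeft M a) m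

lemma tens_neg (m : M) (a : A) : tens m (-a) = - tens m a := map_neg (tensRight A m) a

lemma tensor_induction {p : TensorObj M A → Prop} (zero : p 0) (tens : ∀ m a, p (tens m a))
    (add : ∀ x y, p x → p y → p (x + y)) (t : TensorObj M A) : p t := by
  obtain ⟨t, rfl⟩ := QuotientAddGroup.mk_surjective t
  induction t using TensorProduct.induction_on with
  | zero => exact zero
  | tmul m a => exact tens m a
  | add x y hx hy => exact add _ _ hx hy

lemma tensorObj_hom_ext {B : Type*} [AddCommGroup B] {f g : TensorObj M A →+ B}
    (h : ∀ m a, f (tens m a) = g (tens m a)) : f = g := tensor_hom_ext h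

/-- The map on the tensor product given by a balanced biadditive map. -/
def tensorLift {B : Type*} [AddCommGroup B] (f : M →+ A →+ B)
    (hf : ∀ (m : M) (r : R) (a : A), f (MulOpposite.op r • m) a = f m (r • a)) :
    TensorObj M A →+ B :=
  QuotientAddGroup.lift (balanced M A) (TensorProduct.liftAddHom f (by simp)) <| by
    refine (AddSubgroup.closure_le _).2 ?_
    rintro _ ⟨m, r, a, rfl⟩
    simp [hf]

@[simp]
lemma tensorLift_tens {B : Type*} [AddCommGroup B] (f : M →+ A →+ B)
    (hf : ∀ (m : M) (r : R) (a : A), f (MulOpposite.op r • m) a = f m (r • a)) (m : M) (a : A) :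
    tensorLift f hf (tens m a) = f m a := rfl

lemma tensor_obj_map_tens (A : LeftMod R) {M M' : RightMod R} (f : M ⟶ M') (m : M) (a : A) :
    ((tensor R).obj A).map f (tens m a) = tens (f m) a := rfl

end Elements

section Presented

variable {ι κ : Type} [Fintype ι] [Fintype κ]

/-- The presentation makes `C ⊗ N` the quotient of `N^ι` by the image of `N^κ`. The proof supplies
the map from `C ⊗ N` to this quotient: expand `m` in the generators with coefficients `s m` and let
them act on `n`. -/
lemma IsPresentedBy.exists_of_sum_tens_eq_zero {C : RightMod R} {rel : κ → ι → Rᵐᵒᵖ} {g : ι → C}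
    (h : IsPresentedBy C rel g) {N : LeftMod R} (c : ι → N) (hc : ∑ i, tens (g i) (c i) = 0) :
    ∃ z : κ → N, ∀ i, ∑ j, (rel j i).unop • z j = c i := by
  classical
  let ρ : (κ → N) →+ (ι → N) := AddMonoidHom.mk' (fun z i => ∑ j, (rel j i).unop • z j) <| by
    intro z z'; ext i; simp [Finset.sum_add_distrib]
  choose s hs using h.span
  let q := QuotientAddGroup.mk' ρ.range
  -- Two coefficient vectors of the same element differ by a combination of relations, so the choice
  -- `s` is harmless modulo the image of `ρ`.
  have key : ∀ (d d' : ι → Rᵐᵒᵖ), ∑ i, d i • g i = ∑ i, d' i • g i → ∀ n : N,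
      q (fun i => (d i).unop • n) = q (fun i => (d' i).unop • n) := by
    intro d d' e n
    obtain ⟨t, ht⟩ := (h.rel_iff (d - d')).1 (by simp [sub_smul, e])
    refine (QuotientAddGroup.eq_iff_sub_mem).2 ⟨fun j => (t j).unop • n, ?_⟩
    ext i
    have := congrArg MulOpposite.unop (ht i)
    simp only [Finset.unop_sum, MulOpposite.unop_mul, Pi.sub_apply,
      MulOpposite.unop_sub] at this
    simp [ρ, smul_smul, ← Finset.sum_smul, this, sub_smul]
  let β : C →+ N →+ ((ι → N) ⧸ ρ.range) := AddMonoidHom.mk' (fun m =>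
      q.comp (AddMonoidHom.mk' (fun n i => (s m i).unop • n) fun n n' => by ext i; simp)) <| by
    intro m m'
    ext n
    refine (key _ (s m + s m') (by simp [add_smul, Finset.sum_add_distrib, hs]) n).trans ?_
    change _ = q _ + q _
    rw [← map_add]
    congr 1
    ext i
    simp [add_smul]
  have hβ : ∀ m (r : R) a, β (MulOpposite.op r • m) a = β m (r • a) := by
    intro m r a
    refine (key _ (MulOpposite.op r • s m) (by simp [mul_smul, ← Finset.smul_sum, hs]) a).trans ?_
    change _ = q _
    congr 1
    ext i
    simp [mul_smul]
  have h1 : ∀ i, β (g i) (c i) = q (Pi.single i (c i)) := by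
    intro i
    refine (key _ (Pi.single i 1) (by rw [hs]; simp [Pi.single_apply]) _).trans ?_
    congr 1
    ext i'
    by_cases e : i' = i
    · subst e; simp
    · simp [e]
  have h2 := congrArg (tensorLift β hβ) hc
  simp only [map_sum, tensorLift_tens, h1, map_zero] at h2
  rw [← map_sum, Finset.univ_sum_single] at h2
  obtain ⟨z, hz⟩ := (QuotientAddGroup.eq_zero_iff _).1 h2
  exact ⟨z, fun i => congrFun hz i⟩

/-- The mirror image of the previous criterion: here the left module is presented, and `M ⊗ A` is
`M^ι` modulo the image of `M^κ`. -/
lemma IsPresentedBy.sum_tens_eq_zero_iff {A : LeftMod R} {rel : κ → ι → R} {g : ι → A}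
    (h : IsPresentedBy A rel g) {M : RightMod R} (c : ι → M) :
    ∑ i, tens (c i) (g i) = 0 ↔
      ∃ z : κ → M, ∀ i, ∑ j, MulOpposite.op (rel j i) • z j = c i := by
  classical
  constructor
  swap
  · rintro ⟨z, hz⟩
    simp only [← hz, sum_tens, op_smul_tens]
    rw [Finset.sum_comm]
    refine Finset.sum_eq_zero fun j _ => ?_
    rw [← tens_sum, h.sum_rel, tens_zero]
  intro hc
  let ρ : (κ → M) →+ (ι → M) :=
    AddMonoidHom.mk' (fun z i => ∑ j, MulOpposite.op (rel j i) • z j) <| by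
      intro z z'; ext i; simp [Finset.sum_add_distrib]
  choose s hs using h.span
  let q := QuotientAddGroup.mk' ρ.range
  have key : ∀ (d d' : ι → R), ∑ i, d i • g i = ∑ i, d' i • g i → ∀ n : M,
      q (fun i => MulOpposite.op (d i) • n) = q (fun i => MulOpposite.op (d' i) • n) := by
    intro d d' e n
    obtain ⟨t, ht⟩ := (h.rel_iff (d - d')).1 (by simp [sub_smul, e])
    refine (QuotientAddGroup.eq_iff_sub_mem).2 ⟨fun j => MulOpposite.op (t j) • n, ?_⟩
    ext i
    have := congrArg MulOpposite.op (ht i)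
    simp only [Finset.op_sum, MulOpposite.op_mul, Pi.sub_apply,
      MulOpposite.op_sub] at this
    simp [ρ, smul_smul, ← Finset.sum_smul, this, sub_smul]
  let β : M →+ A →+ ((ι → M) ⧸ ρ.range) := AddMonoidHom.flip <| AddMonoidHom.mk' (fun a =>
      q.comp (AddMonoidHom.mk' (fun n i => MulOpposite.op (s a i) • n)
        fun n n' => by ext i; simp)) <| by
    intro a a'
    ext n
    refine (key _ (s a + s a') (by simp [add_smul, Finset.sum_add_distrib, hs]) n).trans ?_
    change _ = q _ + q _
    rw [← map_add]
    congr 1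
    ext i
    simp [add_smul]
  have hβ : ∀ m (r : R) a, β (MulOpposite.op r • m) a = β m (r • a) := by
    intro m r a
    refine Eq.symm
      ((key _ (r • s a) (by simp [mul_smul, ← Finset.smul_sum, hs]) m).trans ?_)
    change _ = q _
    congr 1
    ext i
    simp [mul_smul]
  have h1 : ∀ i, β (c i) (g i) = q (Pi.single i (c i)) := by
    intro i
    refine (key _ (Pi.single i 1) (by rw [hs]; simp [Pi.single_apply]) _).trans ?_
    congr 1
    ext i'
    by_cases e : i' = i
    · subst e; simp
    · simp [e]
  have h2 := congrArg (tensorLift β hβ) hc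
  simp only [map_sum, tensorLift_tens, h1, map_zero] at h2
  rw [← map_sum, Finset.univ_sum_single] at h2
  obtain ⟨z, hz⟩ := (QuotientAddGroup.eq_zero_iff _).1 h2
  exact ⟨z, fun i => congrFun hz i⟩

lemma IsPresentedBy.exists_sum_tens {A : LeftMod R} {rel : κ → ι → R} {g : ι → A}
    (h : IsPresentedBy A rel g) {M : RightMod R} (t : TensorObj M A) :
    ∃ c : ι → M, ∑ i, tens (c i) (g i) = t := by
  induction t using tensor_induction with
  | zero => exact ⟨0, by simp [zero_tens]⟩
  | tens m a =>
    obtain ⟨s, rfl⟩ := h.span a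
    exact ⟨fun i => MulOpposite.op (s i) • m, by simp [op_smul_tens, tens_sum]⟩
  | add x y hx hy =>
    obtain ⟨c, rfl⟩ := hx
    obtain ⟨d, rfl⟩ := hy
    exact ⟨c + d, by simp [add_tens, Finset.sum_add_distrib]⟩

end Presented

instance (A : LeftMod R) : ((tensor R).obj A).Additive where
  map_add {_ _ f g} := AddCommGrpCat.hom_ext (tensor_hom_ext fun m a => add_tens (f m) (g m) a)

/-- The projection of `V ⊗ A` onto its quotient by the image of `U ⊗ A` factors through `cokernel a
⊗ A`, by lifting elements of the cokernel to `V`; hence whatever dies in `cokernel a ⊗ A` lies in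
that image. -/
lemma isRightExact_tensor (A : LeftMod R) : IsRightExact ((tensor R).obj A) := by
  intro U V a v hv
  have hsurj : Function.Surjective (cokernel.π a) :=
    (ModuleCat.epi_iff_surjective _).1 inferInstance
  have hex := (ShortComplex.moduleCat_exact_iff _).1 (ShortComplex.exact_cokernel a)
  choose s hs using hsurj
  let ρ : TensorObj U A →+ TensorObj V A := (((tensor R).obj A).map a).hom
  let q := QuotientAddGroup.mk' ρ.range
  have key : ∀ (x y : V), cokernel.π a x = cokernel.π a y → ∀ b : A,
      q (tens x b) = q (tens y b) := by
    intro x y e b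
    obtain ⟨w, hw⟩ := hex (x - y) (by simpa [sub_eq_zero] using e)
    refine (QuotientAddGroup.eq_iff_sub_mem).2 ⟨tens w b, ?_⟩
    change tens (a w) b = _
    change a w = x - y at hw
    rw [hw, sub_eq_add_neg, add_tens, neg_tens, sub_eq_add_neg]
  let β : (cokernel a : RightMod R) →+ A →+ (TensorObj V A ⧸ ρ.range) :=
    AddMonoidHom.mk' (fun m => q.comp (tensRight A (s m))) <| by
      intro m m'
      ext b
      refine (key _ (s m + s m') (by simp [hs]) b).trans ?_
      rw [add_tens, map_add]
      rfl
  have hβ : ∀ m (r : R) b, β (MulOpposite.op r • m) b = β m (r • b) := by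
    intro m r b
    refine (key _ (MulOpposite.op r • s m) (by simp [hs]) b).trans ?_
    rw [op_smul_tens]
    rfl
  have h1 : (tensorLift β hβ).comp (((tensor R).obj A).map (cokernel.π a)).hom = q :=
    tensorObj_hom_ext fun m b => key _ _ (hs _) b
  have h2 : q v = 0 := by
    rw [← h1]
    exact (congrArg (tensorLift β hβ) hv).trans (map_zero _)
  exact (QuotientAddGroup.eq_zero_iff _).1 h2

/-- The map `R ⟶ M` of right modules with value `m` at `1`. -/
def ofElement {M : RightMod R} (m : M) : regular R ⟶ M :=
  ModuleCat.ofHom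
    { toFun := fun r => MulOpposite.op r • m
      map_add' := fun x y => by rw [MulOpposite.op_add, add_smul]
      map_smul' := fun s x => by
        rw [smul_smul]; rfl }

lemma ofElement_one {M : RightMod R} (m : M) : ofElement m (1 : R) = m := one_smul _ m

/-- The multiplication `R ⊗ A ⟶ A`. -/
def tensorMul (A : LeftMod R) : TensorObj (regular R) A →+ A :=
  tensorLift (M := regular R) (AddMonoidHom.mk' (fun r : R => DistribSMul.toAddMonoidHom A r) fun r s => by
    ext a; exact add_smul r s a) fun m r a => mul_smul m r a

@[simp]
lemma tensorMul_tens {A : LeftMod R} (r : R) (a : A) :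
    tensorMul A (tens (M := regular R) r a) = r • a := rfl

lemma tensorMul_map_leftMul {A : LeftMod R} (r : R) (t : TensorObj (regular R) A) :
    tensorMul A (((tensor R).obj A).map (leftMul r) t) = r • tensorMul A t := by
  induction t using tensor_induction with
  | zero => rw [map_zero, map_zero, smul_zero]
  | tens m a => exact mul_smul r m a
  | add x y hx hy => rw [map_add, map_add, hx, hy, map_add, smul_add]

lemma one_tens_tensorMul {A : LeftMod R} (t : TensorObj (regular R) A) :
    tens (M := regular R) (1 : R) (tensorMul A t) = t := by
  induction t using tensor_induction with
  | zero => rw [map_zero, tens_zero]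
  | tens m a =>
    rw [tensorMul_tens, ← op_smul_tens]
    congr 1
    exact one_mul _
  | add x y hx hy => rw [map_add, tens_add, hx, hy]

lemma tens_eq_map_ofElement {M : RightMod R} {A : LeftMod R} (m : M) (a : A) :
    tens m a = ((tensor R).obj A).map (ofElement m) (tens (M := regular R) (1 : R) a) := by
  rw [tensor_obj_map_tens, ofElement_one]

/-- Every `m ⊗ a` is the image of `1 ⊗ a` under the map `R ⟶ M` with value `m` at `1`. -/
lemma tensor_natTrans_ext {A : LeftMod R} {F : RightMod R ⥤ AddCommGrpCat.{u}}
    {α β : (tensor R).obj A ⟶ F}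
    (h : ∀ a : A, α.app (regular R) (tens (M := regular R) (1 : R) a) =
      β.app (regular R) (tens (M := regular R) (1 : R) a)) : α = β := by
  ext M : 2
  refine AddCommGrpCat.hom_ext (tensor_hom_ext fun m a => ?_)
  change α.app M (tens m a) = β.app M (tens m a)
  rw [tens_eq_map_ofElement, nat_apply, nat_apply, h]

/-- The functor `A ↦ - ⊗ A` is full. -/
lemma exists_tensor_map_eq {A B : LeftMod R} (τ : (tensor R).obj A ⟶ (tensor R).obj B) :
    ∃ b : A ⟶ B, (tensor R).map b = τ := by
  let T : A → TensorObj (regular R) B := fun a => τ.app (regular R) (tens (M := regular R) (1 : R) a)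
  -- Naturality at left multiplication by `r` makes the map linear, since `1 ⊗ r a = r ⊗ a` is the
  -- image of `1 ⊗ a`.
  have hT : ∀ (r : R) (a : A), T (r • a) = ((tensor R).obj B).map (leftMul r) (T a) := by
    intro r a
    have h1 : tens (M := regular R) (1 : R) (r • a) =
        ((tensor R).obj A).map (leftMul r) (tens (M := regular R) (1 : R) a) := by
      rw [← op_smul_tens, tensor_obj_map_tens]
      congr 1
      exact (one_mul r).trans (mul_one r).symm
    change τ.app (regular R) _ = _
    rw [h1, nat_apply]
  refine ⟨ModuleCat.ofHom { toFun := fun a => tensorMul B (T a)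
                            map_add' := fun a a' => ?_
                            map_smul' := fun r a => ?_ }, ?_⟩
  · rw [← map_add]
    congr 1
    change τ.app (regular R) _ = τ.app (regular R) _ + τ.app (regular R) _
    rw [tens_add, map_add]
  · rw [hT, tensorMul_map_leftMul]; rfl
  · refine tensor_natTrans_ext fun a => ?_
    exact one_tens_tensorMul (T a)

lemma tensor_map_injective {A B : LeftMod R} {b b' : A ⟶ B}
    (h : (tensor R).map b = (tensor R).map b') : b = b' := by
  ext a
  have := congrArg (fun τ : (tensor R).obj A ⟶ (tensor R).obj B =>
    tensorMul B (τ.app (regular R) (tens (M := regular R) (1 : R) a))) h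
  exact (one_smul R (b a)).symm.trans (this.trans (one_smul R (b' a)))

/-- With no relations the module is free on its finite family of generators. -/
lemma IsPresentedBy.projective {S : Type u} [Ring S] {ι κ : Type} [Fintype ι] [Fintype κ]
    [IsEmpty κ] {P : ModuleCat.{u} S} {rel : κ → ι → S} {e : ι → P}
    (h : IsPresentedBy P rel e) : Projective P where
  factors {E X} f p hp := by
    choose s hs using (ModuleCat.epi_iff_surjective p).1 hp
    obtain ⟨l, hl⟩ := h.exists_hom (fun i => s (f (e i))) isEmptyElim
    exact ⟨l, h.hom_ext fun i => by simp [hl, hs]⟩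

/-- If `A` is finitely presented, then `- ⊗ A` is presented by free modules of finite rank. -/
lemma exists_presents_tensor {A : LeftMod R} (hA : isFPModule R A) :
    ∃ (P Q : RightMod R) (_ : isFPModule Rᵐᵒᵖ P) (_ : isFPModule Rᵐᵒᵖ Q) (_ : Projective P)
      (_ : Projective Q) (f : P ⟶ Q) (x : ((tensor R).obj A).obj P),
      Presents ((tensor R).obj A) f x := by
  obtain ⟨n, m, rel, g, hg⟩ := exists_isPresentedBy_of_isFPModule hA
  obtain ⟨P, e, he⟩ := exists_isPresentedBy (S := Rᵐᵒᵖ) (fun (_ : Empty) (_ : Fin n) => 0)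
  obtain ⟨Q, e', he'⟩ := exists_isPresentedBy (S := Rᵐᵒᵖ) (fun (_ : Empty) (_ : Fin m) => 0)
  -- `f` is the transpose of the relations of `A`: under `Hom(P, M) = Mⁿ` and `Hom(Q, M) = Mᵐ`,
  -- composition with `f` is the map `Mᵐ → Mⁿ` whose cokernel is `M ⊗ A`.
  obtain ⟨f, hf⟩ := he.exists_hom (fun i => ∑ j, MulOpposite.op (rel j i) • e' j) isEmptyElim
  have hmap : ∀ (M : RightMod R) (h : P ⟶ M), ((tensor R).obj A).map h (∑ i, tens (e i) (g i)) =
      ∑ i, tens (h (e i)) (g i) := by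
    intro M h
    rw [map_sum]
    rfl
  refine ⟨P, Q, he.isFPModule, he'.isFPModule, he.projective, he'.projective, f,
    ∑ i, tens (e i) (g i), fun M z => ?_, fun M h => ?_⟩
  · obtain ⟨c, rfl⟩ := hg.exists_sum_tens z
    obtain ⟨h, hh⟩ := he.exists_hom c isEmptyElim
    exact ⟨h, by rw [hmap]; simp only [hh]⟩
  · rw [hmap, hg.sum_tens_eq_zero_iff]
    constructor
    · rintro ⟨z, hz⟩
      obtain ⟨k, hk⟩ := he'.exists_hom z isEmptyElim
      exact ⟨k, he.hom_ext fun i => by simp [hf, hk, hz]⟩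
    · rintro ⟨k, rfl⟩
      exact ⟨fun j => k (e' j), fun i => by simp [hf]⟩

end TensorProducts

/-! ### Positive primitive formulas, their free realisations and the duality pairing. -/

section Formulas

section Pairs

variable {S : Type u} [Ring S] {n : ℕ}

namespace PPFormula

/-- The coefficients of the equations of a formula, in the free and in the bound variables. -/
def rel (φ : PPFormula S n) : Fin φ.numEqs → Fin n ⊕ Fin φ.numVars → S :=
  fun j => Sum.elim (φ.free j) (φ.bound j)

/-- A module presented by the equations of `φ` carries a generic solution, of which every other
solution is an image. -/
lemma mem_sol_of_isPresentedBy (φ : PPFormula S n) {M : ModuleCat.{u} S}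
    {g : Fin n ⊕ Fin φ.numVars → M} (h : IsPresentedBy M φ.rel g) :
    (fun i => g (Sum.inl i)) ∈ φ.sol M :=
  ⟨fun l => g (Sum.inr l), fun j => by
    simpa [rel, Fintype.sum_sum_type] using h.sum_rel j⟩

end PPFormula

/-- The class of a solution. -/
def ppMk (φ ψ : PPFormula S n) {M : ModuleCat.{u} S} (a : φ.sol M) : (ppPair φ ψ).obj M :=
  QuotientAddGroup.mk a

variable {φ ψ : PPFormula S n}

lemma ppMk_surjective {M : ModuleCat.{u} S} (x : (ppPair φ ψ).obj M) :
    ∃ a : φ.sol M, ppMk φ ψ a = x := QuotientAddGroup.mk_surjective x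

lemma ppPair_map_ppMk {M N : ModuleCat.{u} S} (f : M ⟶ N) (a : φ.sol M) :
    (ppPair φ ψ).map f (ppMk φ ψ a) = ppMk φ ψ (φ.solMap f a) := rfl

lemma ppMk_add {M : ModuleCat.{u} S} (a b : φ.sol M) :
    ppMk φ ψ (a + b) = ppMk φ ψ a + ppMk φ ψ b := rfl

lemma ppMk_eq_zero_iff {M : ModuleCat.{u} S} (a : φ.sol M) :
    ppMk φ ψ a = 0 ↔ a.1 ∈ ψ.sol M :=
  (QuotientAddGroup.eq_zero_iff a).trans AddSubgroup.mem_addSubgroupOf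

instance (φ ψ : PPFormula S n) : (ppPair φ ψ).Additive where
  map_add {M N f g} := by
    ext x
    obtain ⟨a, rfl⟩ := ppMk_surjective x
    change ppMk φ ψ (φ.solMap (f + g) a) = ppMk φ ψ (φ.solMap f a) + ppMk φ ψ (φ.solMap g a)
    rw [← ppMk_add]
    rfl

-- `X` is the free realisation of `φ`, and `Y` adjoins to it generic witnesses that the same tuple
-- satisfies `ψ`. A map out of `X` is a solution of `φ` with its witnesses, and it extends to `Y`
-- exactly when the solution satisfies `ψ`.
variable (φ ψ) in
lemma exists_presents_ppPair : ∃ (X Y : ModuleCat.{u} S) (_ : isFPModule S X)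
    (_ : isFPModule S Y) (f : X ⟶ Y) (x : (ppPair φ ψ).obj X), Presents (ppPair φ ψ) f x := by
  obtain ⟨X, g, hg⟩ := exists_isPresentedBy φ.rel
  let rel' : Fin φ.numEqs ⊕ Fin ψ.numEqs → (Fin n ⊕ Fin φ.numVars) ⊕ Fin ψ.numVars → S :=
    Sum.elim (fun j => Sum.elim (φ.rel j) 0)
      (fun j => Sum.elim (Sum.elim (ψ.free j) 0) (ψ.bound j))
  obtain ⟨Y, g', hg'⟩ := exists_isPresentedBy rel'
  obtain ⟨f, hf⟩ := hg.exists_hom (fun i => g' (Sum.inl i)) fun j => by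
    simpa [rel', Fintype.sum_sum_type] using hg'.sum_rel (Sum.inl j)
  refine ⟨X, Y, hg.isFPModule, hg'.isFPModule, f,
    ppMk φ ψ ⟨_, φ.mem_sol_of_isPresentedBy hg⟩, fun M z => ?_, fun M h => ?_⟩
  · obtain ⟨⟨a, y, hy⟩, rfl⟩ := ppMk_surjective z
    obtain ⟨h, hh⟩ := hg.exists_hom (Sum.elim a y) fun j => by
      simpa [PPFormula.rel, Fintype.sum_sum_type] using hy j
    refine ⟨h, ?_⟩
    rw [ppPair_map_ppMk]
    congr 1
    exact Subtype.ext (funext fun i => hh (Sum.inl i))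
  · rw [ppPair_map_ppMk, ppMk_eq_zero_iff]
    constructor
    · rintro ⟨y, hy⟩
      obtain ⟨k, hk⟩ := hg'.exists_hom (Sum.elim (fun i => h (g i)) y) <| by
        rintro (j | j)
        · have := congrArg h (hg.sum_rel j)
          simpa [rel', Fintype.sum_sum_type] using this
        · simpa [rel', Fintype.sum_sum_type, PPFormula.solMap] using hy j
      exact ⟨k, hg.hom_ext fun i => by simp [hf, hk]⟩
    · rintro ⟨k, rfl⟩
      refine ⟨fun l => k (g' (Sum.inr l)), fun j => ?_⟩
      have := congrArg k (hg'.sum_rel (Sum.inr j))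
      simpa [rel', Fintype.sum_sum_type, PPFormula.solMap, hf] using this

lemma isTFP_ppPair (φ ψ : PPFormula S n) : isTFP S (ppPair φ ψ) := by
  obtain ⟨X, Y, hX, hY, f, x, h⟩ := exists_presents_ppPair φ ψ
  exact h.hasPresentation hX hY

/-- Every totally finitely presented functor is given by a pair of formulas. -/
lemma exists_iso_ppPair (F : TFP S) : ∃ (n : ℕ) (φ ψ : PPFormula S n),
    (∀ M, ψ.sol M ≤ φ.sol M) ∧ Nonempty (F.obj ≅ ppPair φ ψ) := by
  obtain ⟨hadd, X, Y, hX, hY, f, x, hx⟩ := HasPresentation.exists_presents F.property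
  obtain ⟨n, m, rel, g, hg⟩ := exists_isPresentedBy_of_isFPModule hX
  obtain ⟨n', m', rel', g', hg'⟩ := exists_isPresentedBy_of_isFPModule hY
  choose p hp using fun i => hg'.span (f (g i))
  -- `φ` has no bound variables and says that a tuple satisfies the relations of `X`, so its
  -- solutions are the maps out of `X`. The first `n` equations of `ψ` say that the tuple is `p`
  -- times `y` and the others that `y` satisfies the relations of `Y`: the map factors through `f`.
  let φ : PPFormula S n := ⟨0, m, rel, fun _ => Fin.elim0⟩
  let ψ : PPFormula S n := ⟨n', n + m',
    Fin.append (fun i i' => if i = i' then 1 else 0) (fun _ _ => 0),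
    Fin.append (fun i l => - p i l) rel'⟩
  have hφ : ∀ (M : ModuleCat.{u} S) (a : Fin n → M),
      a ∈ φ.sol M ↔ ∀ j, ∑ i, rel j i • a i = 0 := by
    intro M a
    change (∃ _ : Fin 0 → M, ∀ j, _ + Finset.sum (Finset.univ : Finset (Fin 0)) _ = 0) ↔ _
    simp [φ]
  have hψ : ∀ (M : ModuleCat.{u} S) (a : Fin n → M), a ∈ ψ.sol M ↔
      ∃ y : Fin n' → M, (∀ i, a i = ∑ l, p i l • y l) ∧ ∀ j, ∑ l, rel' j l • y l = 0 := by
    intro M a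
    refine exists_congr fun y => ?_
    refine (Fin.forall_fin_add _).trans ?_
    simp [ψ, ite_smul, ← sub_eq_add_neg, sub_eq_zero]
  have hψ' : ∀ (M : ModuleCat.{u} S) (a : Fin n → M), a ∈ ψ.sol M ↔
      ∃ k : Y ⟶ M, ∀ i, k (f (g i)) = a i := by
    intro M a
    rw [hψ]
    constructor
    · rintro ⟨y, hy, hy'⟩
      obtain ⟨k, hk⟩ := hg'.exists_hom y hy'
      exact ⟨k, fun i => by simp [← hp, hk, hy]⟩
    · rintro ⟨k, hk⟩
      refine ⟨fun l => k (g' l), fun i => by simp [← hk, ← hp], fun j => ?_⟩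
      simpa using congrArg k (hg'.sum_rel j)
  have hle : ∀ M, ψ.sol M ≤ φ.sol M := by
    intro M a ha
    obtain ⟨k, hk⟩ := (hψ' M a).1 ha
    refine (hφ M a).2 fun j => ?_
    simpa [hk] using congrArg (fun t => k (f t)) (hg.sum_rel j)
  have hpres : Presents (ppPair φ ψ) f (ppMk φ ψ ⟨g, (hφ X g).2 hg.sum_rel⟩) := by
    refine ⟨fun M z => ?_, fun M h => ?_⟩
    · obtain ⟨⟨a, ha⟩, rfl⟩ := ppMk_surjective z
      obtain ⟨h, hh⟩ := hg.exists_hom a ((hφ M a).1 ha)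
      refine ⟨h, ?_⟩
      rw [ppPair_map_ppMk]
      congr 1
      exact Subtype.ext (funext hh)
    · rw [ppPair_map_ppMk, ppMk_eq_zero_iff, hψ']
      refine exists_congr fun k => ⟨fun e => hg.hom_ext e, ?_⟩
      rintro rfl i
      rfl
  obtain ⟨e, -⟩ := hx.exists_iso hpres
  exact ⟨n, φ, ψ, hle, ⟨e⟩⟩

end Pairs

variable {R : Type u} [Ring R] {n : ℕ}

/-- The pairing `∑ k, a k ⊗ b k` of tuples. -/
def pairing {M : RightMod R} {N : LeftMod R} (a : Fin n → M) (b : Fin n → N) : TensorObj M N :=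
  ∑ k, tens (a k) (b k)

lemma pairing_add_left {M : RightMod R} {N : LeftMod R} (a a' : Fin n → M) (b : Fin n → N) :
    pairing (a + a') b = pairing a b + pairing a' b := by
  simp [pairing, add_tens, Finset.sum_add_distrib]

lemma pairing_add_right {M : RightMod R} {N : LeftMod R} (a : Fin n → M) (b b' : Fin n → N) :
    pairing a (b + b') = pairing a b + pairing a b' := by
  simp [pairing, tens_add, Finset.sum_add_distrib]

lemma map_pairing {M M' : RightMod R} {N : LeftMod R} (f : M ⟶ M') (a : Fin n → M)
    (b : Fin n → N) :
    ((tensor R).obj N).map f (pairing a b) = pairing (fun i => f (a i)) b := by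
  rw [pairing, map_sum]
  rfl

lemma tensor_map_pairing {M : RightMod R} {N N' : LeftMod R} (g : N ⟶ N') (a : Fin n → M)
    (b : Fin n → N) :
    ((tensor R).map g).app M (pairing a b) = pairing a (fun i => g (b i)) := by
  rw [pairing, map_sum]
  rfl

namespace PPFormula

/-- With `a A + y B = 0`, `b = -A z` and `B z = 0` one has `a ⊗ b = -(a A) ⊗ z = (y B) ⊗ z = y ⊗ B z
= 0`. -/
lemma pairing_eq_zero (φ : PPFormula Rᵐᵒᵖ n) {M : RightMod R} {N : LeftMod R} {a : Fin n → M}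
    {b : Fin n → N} (ha : a ∈ φ.sol M) (hb : b ∈ φ.dual.sol N) : pairing a b = 0 := by
  obtain ⟨y, hy⟩ := ha
  obtain ⟨z, hz, hz'⟩ := (φ.mem_dual_sol N b).1 hb
  have h1 : ∀ i, b i = - ∑ j, (φ.free j i).unop • z j := fun i => eq_neg_of_add_eq_zero_left (hz i)
  have h2 : ∀ j, ∑ i, φ.free j i • a i = - ∑ l, φ.bound j l • y l :=
    fun j => eq_neg_of_add_eq_zero_left (hy j)
  calc pairing a b = - ∑ i, ∑ j, tens (φ.free j i • a i) (z j) := by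
        simp only [pairing, h1, tens_neg, tens_sum, Finset.sum_neg_distrib, ← op_smul_tens,
          MulOpposite.op_unop]
    _ = ∑ j, ∑ l, tens (φ.bound j l • y l) (z j) := by
        rw [Finset.sum_comm]
        simp only [← sum_tens, h2, neg_tens, Finset.sum_neg_distrib, neg_neg]
    _ = ∑ l, tens (y l) (∑ j, (φ.bound j l).unop • z j) := by
        rw [Finset.sum_comm]
        simp only [tens_sum, ← op_smul_tens, MulOpposite.op_unop]
    _ = 0 := by simp only [hz', tens_zero, Finset.sum_const_zero]

/-- The tuples of the dual formula are those annihilated by the formula. -/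
lemma mem_dual_sol_iff (φ : PPFormula Rᵐᵒᵖ n) (N : LeftMod R) (b : Fin n → N) :
    b ∈ φ.dual.sol N ↔ ∀ (M : RightMod R), ∀ a ∈ φ.sol M, pairing a b = 0 := by
  refine ⟨fun hb M a ha => φ.pairing_eq_zero ha hb, fun h => ?_⟩
  -- It suffices to test on the generic solution of `φ`. Padding `b` with zeros at the bound
  -- variables turns orthogonality into a relation among all generators of the free realisation, and
  -- the coefficients `z` it provides are a witness up to sign.
  obtain ⟨M, g, hg⟩ := exists_isPresentedBy φ.rel
  obtain ⟨z, hz⟩ := hg.exists_of_sum_tens_eq_zero (Sum.elim b 0) (by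
    rw [Fintype.sum_sum_type]
    simpa [tens_zero, pairing] using h M _ (φ.mem_sol_of_isPresentedBy hg))
  refine (φ.mem_dual_sol N b).2 ⟨-z, fun i => ?_, fun l => ?_⟩
  · have := hz (Sum.inl i)
    simp only [rel, Sum.elim_inl] at this
    simp [this]
  · have := hz (Sum.inr l)
    simp only [rel, Sum.elim_inr] at this
    simp [this]

lemma dual_sol_le {φ ψ : PPFormula Rᵐᵒᵖ n} (h : ∀ M, ψ.sol M ≤ φ.sol M) (N : LeftMod R) :
    φ.dual.sol N ≤ ψ.dual.sol N := fun b hb =>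
  (ψ.mem_dual_sol_iff N b).2 fun M _ ha => φ.pairing_eq_zero (h M ha) hb

end PPFormula

/-! ### Transformations from a pair of formulas to a tensor product functor. -/

section PairingHom

variable (φ ψ : PPFormula Rᵐᵒᵖ n)

/-- The transformation `φ / ψ ⟶ - ⊗ N` given by the pairing with a solution of the dual of `ψ`. -/
def pairingHom {N : LeftMod R} (b : ψ.dual.sol N) : ppPair φ ψ ⟶ (tensor R).obj N where
  app M := AddCommGrpCat.ofHom <| QuotientAddGroup.lift _
    (AddMonoidHom.mk' (fun a : φ.sol M => pairing a.1 b.1)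
      fun a a' => pairing_add_left a.1 a'.1 b.1)
    fun a ha => ψ.pairing_eq_zero ha b.2
  naturality M M' f := by
    ext x
    obtain ⟨a, rfl⟩ := ppMk_surjective x
    exact (map_pairing f a.1 b.1).symm

variable {φ ψ}

lemma pairingHom_app {N : LeftMod R} (b : ψ.dual.sol N) {M : RightMod R} (a : φ.sol M) :
    (pairingHom φ ψ b).app M (ppMk φ ψ a) = pairing a.1 b.1 := rfl

lemma pp_natTrans_ext {F : RightMod R ⥤ AddCommGrpCat.{u}} {α β : ppPair φ ψ ⟶ F}
    (h : ∀ (M : RightMod R) (a : φ.sol M),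
      α.app M (ppMk φ ψ a) = β.app M (ppMk φ ψ a)) : α = β := by
  ext M x
  obtain ⟨a, rfl⟩ := ppMk_surjective x
  exact h M a

lemma pairingHom_eq_zero_iff {N : LeftMod R} (b : ψ.dual.sol N) :
    pairingHom φ ψ b = 0 ↔ b.1 ∈ φ.dual.sol N := by
  rw [φ.mem_dual_sol_iff]
  constructor
  · intro h M a ha
    have := pairingHom_app (φ := φ) b ⟨a, ha⟩
    rw [h] at this
    exact this.symm
  · intro h
    exact pp_natTrans_ext fun M a => h M a.1 a.2

/-- The transformations `φ / ψ ⟶ - ⊗ N` are given by the solutions of the dual of `ψ`. -/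
lemma pairingHom_surjective {N : LeftMod R}
    (η : ppPair φ ψ ⟶ (tensor R).obj N) : ∃ b : ψ.dual.sol N, pairingHom φ ψ b = η := by
  -- `t` has no equations and is always true, so `t / ψ` sends `M` to `Mⁿ / ψ(M)` and contains `φ /
  -- ψ`. Right exactness of `- ⊗ N` extends `η` to it.
  let t : PPFormula Rᵐᵒᵖ n := ⟨0, 0, Fin.elim0, Fin.elim0⟩
  have ht : ∀ (M : RightMod R) (a : Fin n → M), a ∈ t.sol M := fun M a =>
    ⟨Fin.elim0, fun j => j.elim0⟩
  let m : ppPair φ ψ ⟶ ppPair t ψ :=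
    { app := fun M => AddCommGrpCat.ofHom <| QuotientAddGroup.map _ _
        (AddSubgroup.inclusion fun a _ => ht M a) fun a ha => ha
      naturality := fun M M' f => by
        ext x
        obtain ⟨a, rfl⟩ := ppMk_surjective x
        rfl }
  have hm : ∀ (M : RightMod R) (a : φ.sol M),
    m.app M (ppMk φ ψ a) = ppMk t ψ ⟨a.1, ht M a.1⟩ := fun _ _ => rfl
  obtain ⟨X, Y, -, -, f, x, hx⟩ := exists_presents_ppPair φ ψ
  obtain ⟨X', Y', -, -, f', x', hx'⟩ := exists_presents_ppPair t ψ
  obtain ⟨ξ, rfl⟩ := hx.exists_extension hx' (isRightExact_tensor N) m η <| by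
    intro M z hz
    obtain ⟨a, rfl⟩ := ppMk_surjective z
    rw [hm, ppMk_eq_zero_iff] at hz
    rw [(ppMk_eq_zero_iff a).2 hz, map_zero]
  -- On the whole of `Mⁿ` the transformation is determined by its value at the basis of the free
  -- module of rank `n`; the coordinates of this value form `b`.
  obtain ⟨P, g, hg⟩ := exists_isPresentedBy (S := Rᵐᵒᵖ) (fun (_ : Empty) (_ : Fin n) => 0)
  let c := ξ.app P (ppMk t ψ ⟨g, ht P g⟩)
  obtain ⟨b, hb⟩ : ∃ b : Fin n → N, pairing g b = c := by
    induction c using tensor_induction with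
    | zero => exact ⟨0, by simp [pairing, tens_zero]⟩
    | tens p a =>
      obtain ⟨s, rfl⟩ := hg.span p
      refine ⟨fun i => (s i).unop • a, ?_⟩
      simp only [pairing, ← op_smul_tens, MulOpposite.op_unop, sum_tens]
    | add y z hy hz =>
      obtain ⟨b, rfl⟩ := hy
      obtain ⟨b', rfl⟩ := hz
      exact ⟨b + b', pairing_add_right g b b'⟩
  have hξ : ∀ (M : RightMod R) (a : Fin n → M),
      ξ.app M (ppMk t ψ ⟨a, ht M a⟩) = pairing a b := by
    intro M a
    obtain ⟨h, hh⟩ := hg.exists_hom a isEmptyElim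
    have : ppMk t ψ ⟨a, ht M a⟩ = (ppPair t ψ).map h (ppMk t ψ ⟨g, ht P g⟩) := by
      rw [ppPair_map_ppMk]
      congr 1
      exact Subtype.ext (funext fun i => (hh i).symm)
    rw [this, nat_apply]
    change _ = _
    rw [show ξ.app P (ppMk t ψ ⟨g, ht P g⟩) = pairing g b from hb.symm, map_pairing]
    simp only [hh]
  refine ⟨⟨b, (ψ.mem_dual_sol_iff N b).2 fun M a ha => ?_⟩, pp_natTrans_ext fun M a => ?_⟩
  -- The extended transformation kills `ψ`, so `b` is orthogonal to `ψ` and therefore solves its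
  -- dual.
  · rw [← hξ, (ppMk_eq_zero_iff _).2 ha, map_zero]
  · change pairing a.1 b = ξ.app M (m.app M (ppMk φ ψ a))
    rw [hm, hξ]

/-- The pairing identifies `Dψ / Dφ` with the transformations `φ / ψ ⟶ - ⊗ N`. -/
def pairingEquiv (N : LeftMod R) :
    (ppPair ψ.dual φ.dual).obj N ≃+ (ppPair φ ψ ⟶ (tensor R).obj N) := by
  let p : ψ.dual.sol N →+ (ppPair φ ψ ⟶ (tensor R).obj N) :=
    AddMonoidHom.mk' (fun b => pairingHom φ ψ b) fun b b' =>
      pp_natTrans_ext fun M a => pairing_add_right a.1 b.1 b'.1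
  have hp : ∀ b, p b = 0 ↔ b.1 ∈ φ.dual.sol N := pairingHom_eq_zero_iff
  let q : (ppPair ψ.dual φ.dual).obj N →+ (ppPair φ ψ ⟶ (tensor R).obj N) :=
    QuotientAddGroup.lift _ p fun b hb => (hp b).2 hb
  refine AddEquiv.ofBijective q ⟨?_, ?_⟩
  · rw [injective_iff_map_eq_zero]
    intro x hx
    obtain ⟨b, rfl⟩ := ppMk_surjective x
    exact (ppMk_eq_zero_iff b).2 ((hp b).1 hx)
  · intro η
    obtain ⟨b, rfl⟩ := pairingHom_surjective η
    exact ⟨ppMk _ _ b, rfl⟩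

lemma pairingEquiv_ppMk {N : LeftMod R} (b : ψ.dual.sol N) :
    pairingEquiv (φ := φ) (ψ := ψ) N (ppMk _ _ b) = pairingHom φ ψ b := rfl

lemma pairingEquiv_map {N N' : LeftMod R} (g : N ⟶ N')
    (x : (ppPair ψ.dual φ.dual).obj N) :
    pairingEquiv (φ := φ) (ψ := ψ) N' ((ppPair ψ.dual φ.dual).map g x) =
      pairingEquiv (φ := φ) (ψ := ψ) N x ≫ (tensor R).map g := by
  obtain ⟨b, rfl⟩ := ppMk_surjective x
  rw [ppPair_map_ppMk, pairingEquiv_ppMk, pairingEquiv_ppMk]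
  exact pp_natTrans_ext fun M a => (tensor_map_pairing g a.1 b.1).symm

variable (φ ψ) in
/-- The functor of a pair of formulas embeds into a tensor product functor. -/
lemma exists_pairingHom_injective : ∃ (A : LeftMod R) (_ : isFPModule R A)
    (b : ψ.dual.sol A), ∀ M, Function.Injective ((pairingHom φ ψ b).app M) := by
  -- `A` is the free realisation of the dual of `ψ`: its generators are the variables `z` subject to
  -- `B z = 0`, and the solution is `-A z` for the free coefficients. By the criterion for vanishing
  -- tensors, `a` pairs to zero with it only if `a A = z B` for some tuple `z`, and then `-z`
  -- witnesses `ψ`.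
  obtain ⟨A, g, hg⟩ := exists_isPresentedBy fun l j => (ψ.bound j l).unop
  refine ⟨A, hg.isFPModule, ⟨fun i => - ∑ j, (ψ.free j i).unop • g j,
    (ψ.mem_dual_sol A _).2 ⟨g, fun i => neg_add_cancel _, hg.sum_rel⟩⟩, fun M => ?_⟩
  rw [injective_iff_map_eq_zero]
  intro x hx
  obtain ⟨a, rfl⟩ := ppMk_surjective x
  rw [pairingHom_app] at hx
  have h1 : ∑ j, tens (∑ i, ψ.free j i • a.1 i) (g j) = 0 := by
    rw [← neg_eq_zero, ← hx]
    simp only [pairing, tens_neg, tens_sum, ← op_smul_tens, MulOpposite.op_unop, sum_tens,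
      Finset.sum_neg_distrib]
    rw [Finset.sum_comm]
  obtain ⟨z, hz⟩ := (hg.sum_tens_eq_zero_iff _).1 h1
  refine (ppMk_eq_zero_iff a).2 ⟨-z, fun j => ?_⟩
  rw [← hz]
  simp

end PairingHom

end Formulas

/-! ### Totally finitely presented functors as kernels of maps `- ⊗ A ⟶ - ⊗ B`. -/

section Copresentations

variable {R : Type u} [Ring R]

instance {S : Type u} [Ring S] (F : TFP S) : F.obj.Additive :=
  (HasPresentation.exists_presents F.property).1

lemma isTFP_tensor {A : LeftMod R} (hA : isFPModule R A) : isTFP Rᵐᵒᵖ ((tensor R).obj A) := by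
  obtain ⟨P, Q, hP, hQ, -, -, f, x, h⟩ := exists_presents_tensor hA
  exact h.hasPresentation hP hQ

lemma exists_embedding_tensor (F : TFP Rᵐᵒᵖ) : ∃ (A : LeftMod R) (_ : isFPModule R A)
    (j : F.obj ⟶ (tensor R).obj A), ∀ M, Function.Injective (j.app M) := by
  obtain ⟨n, φ, ψ, -, ⟨e⟩⟩ := exists_iso_ppPair F
  obtain ⟨A, hA, b, hb⟩ := exists_pairingHom_injective φ ψ
  refine ⟨A, hA, e.hom ≫ pairingHom φ ψ b, fun M x y h => ?_⟩
  have h1 := congrArg (e.inv.app M) (hb M h)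
  have h2 : ∀ z, e.inv.app M (e.hom.app M z) = z :=
    fun z => ConcreteCategory.congr_hom (e.hom_inv_id_app M) z
  exact (h2 x).symm.trans (h1.trans (h2 y))

/-- The presentation of a cokernel uses a biproduct, and that of a kernel uses pushouts; finitely
presented modules are closed under both. -/
lemma isTFP_cokernel {S : Type u} [Ring S] {F G : ModuleCat.{u} S ⥤ AddCommGrpCat.{u}}
    (hF : isTFP S F) (hG : isTFP S G) (α : F ⟶ G) : isTFP S (cokernel α) := by
  obtain ⟨-, X₀, X₁, hX₀, hX₁, f, x, hx⟩ := HasPresentation.exists_presents hF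
  obtain ⟨hGa, Y₀, Y₁, hY₀, hY₁, g, y, hy⟩ := HasPresentation.exists_presents hG
  have hsurj : ∀ A, Function.Surjective ((cokernel.π α).app A) := fun A =>
    (AddCommGrpCat.epi_iff_surjective _).1 inferInstance
  have : (cokernel α).Additive := additive_of_surjective _ hsurj
  obtain ⟨a, ha⟩ := hx.exists_presents_cokernel hy α (cokernel.π α) hsurj
    (exact_app (ShortComplex.exact_cokernel α))
  exact ha.hasPresentation hY₀ (isFPModule_biprod hY₁ hX₀)

lemma isTFP_kernel {S : Type u} [Ring S] {F G : ModuleCat.{u} S ⥤ AddCommGrpCat.{u}}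
    (hF : isTFP S F) (hG : isTFP S G) (α : F ⟶ G) : isTFP S (kernel α) := by
  obtain ⟨hFa, X₀, X₁, hX₀, hX₁, f, x, hx⟩ := HasPresentation.exists_presents hF
  obtain ⟨hGa, Y₀, Y₁, hY₀, hY₁, g, y, hy⟩ := HasPresentation.exists_presents hG
  have hinj : ∀ A, Function.Injective ((kernel.ι α).app A) := fun A =>
    (AddCommGrpCat.mono_iff_injective _).1 inferInstance
  have : (kernel α).Additive := additive_of_injective _ hinj
  obtain ⟨a, q, hq⟩ := hx.exists_presents_kernel hy (kernel.ι α) α hinj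
    (exact_app (ShortComplex.exact_kernel α))
  have h1 := isFPModule_pushout hY₀ hX₀ hY₁ a g
  exact hq.hasPresentation h1 (isFPModule_pushout hX₀ h1 hX₁ _ _)

/-- A totally finitely presented functor is the kernel of a map of tensor product functors. -/
structure IsCopresentedBy (F : RightMod R ⥤ AddCommGrpCat.{u}) {A B : LeftMod R} (k : A ⟶ B)
    (j : F ⟶ (tensor R).obj A) : Prop where
  injective : ∀ M, Function.Injective (j.app M)
  exactSeq : ExactSeq j ((tensor R).map k)

/-- After embedding `F` in `- ⊗ A`, the cokernel is again totally finitely presented and embeds in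
some `- ⊗ B`; fullness of the tensor embedding turns the composite into a module map `k`. -/
lemma exists_isCopresentedBy (F : TFP Rᵐᵒᵖ) : ∃ (A B : LeftMod R) (_ : isFPModule R A)
    (_ : isFPModule R B) (k : A ⟶ B) (j : F.obj ⟶ (tensor R).obj A),
      IsCopresentedBy F.obj k j := by
  obtain ⟨A, hA, j, hj⟩ := exists_embedding_tensor F
  obtain ⟨B, hB, l, hl⟩ :=
    exists_embedding_tensor ⟨_, isTFP_cokernel F.property (isTFP_tensor hA) j⟩
  obtain ⟨k, hk⟩ := exists_tensor_map_eq (cokernel.π j ≫ l)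
  refine ⟨A, B, hA, hB, k, j, hj, fun M t => ?_⟩
  rw [hk, ← exact_app (ShortComplex.exact_cokernel j) M t]
  change l.app M _ = 0 ↔ _
  exact ⟨fun h => hl M (h.trans (map_zero _).symm),
    fun h => (congrArg (l.app M) h).trans (map_zero _)⟩

lemma exists_isCopresentedBy_of_hom {A B : LeftMod R} (hA : isFPModule R A)
    (hB : isFPModule R B) (k : A ⟶ B) : ∃ (F : TFP Rᵐᵒᵖ) (j : F.obj ⟶ (tensor R).obj A),
      IsCopresentedBy F.obj k j :=
  ⟨⟨_, isTFP_kernel (isTFP_tensor hA) (isTFP_tensor hB) ((tensor R).map k)⟩, kernel.ι _,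
    fun _ => (AddCommGrpCat.mono_iff_injective _).1 inferInstance,
    exact_app (ShortComplex.exact_kernel _)⟩

namespace IsCopresentedBy

variable {F G : RightMod R ⥤ AddCommGrpCat.{u}} {A B : LeftMod R} {k : A ⟶ B}
  {j : F ⟶ (tensor R).obj A}

lemma comp_eq_zero (h : IsCopresentedBy F k j) : j ≫ (tensor R).map k = 0 := by
  ext M x
  exact (h.exactSeq M _).2 ⟨x, rfl⟩

lemma exists_lift (h : IsCopresentedBy F k j) (m : G ⟶ (tensor R).obj A)
    (hm : m ≫ (tensor R).map k = 0) : ∃ l : G ⟶ F, l ≫ j = m := by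
  have h1 : ∀ M x, ∃ y, j.app M y = m.app M x := fun M x =>
    (h.exactSeq M _).1 (ConcreteCategory.congr_hom (NatTrans.congr_app hm M) x)
  choose s hs using h1
  refine ⟨{ app := fun M => AddCommGrpCat.ofHom (AddMonoidHom.mk' (s M) fun x y => ?_)
            naturality := fun M M' f => ?_ }, ?_⟩
  · apply h.injective
    rw [map_add, hs, hs, hs, map_add]
  · ext x
    apply h.injective
    change j.app M' (s M' (G.map f x)) = j.app M' (F.map f (s M x))
    rw [hs, nat_apply, nat_apply, hs]
  · ext M x
    exact hs M x

lemma mono (h : IsCopresentedBy F k j) : Mono j := by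
  have : ∀ M, Mono (j.app M) := fun M => (AddCommGrpCat.mono_iff_injective _).2 (h.injective M)
  exact NatTrans.mono_of_mono_app j

end IsCopresentedBy

/-- Maps from a functor into `- ⊗ C` extend along a copresentation. -/
lemma IsCopresentedBy.exists_extension {F : TFP Rᵐᵒᵖ} {A B : LeftMod R} {k : A ⟶ B}
    {j : F.obj ⟶ (tensor R).obj A} (h : IsCopresentedBy F.obj k j) (hA : isFPModule R A)
    {C : LeftMod R} (m : F.obj ⟶ (tensor R).obj C) : ∃ c : A ⟶ C, j ≫ (tensor R).map c = m := by
  obtain ⟨-, X, Y, -, -, f, x, hx⟩ := HasPresentation.exists_presents F.property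
  obtain ⟨P, Q, -, -, -, -, g, y, hy⟩ := exists_presents_tensor hA
  obtain ⟨τ, hτ⟩ := hx.exists_extension hy (isRightExact_tensor C) j m fun M z hz => by
    rw [h.injective M (hz.trans (map_zero _).symm), map_zero]
  obtain ⟨c, rfl⟩ := exists_tensor_map_eq τ
  exact ⟨c, hτ⟩

/-- If `- ⊗ c` kills the kernel of `- ⊗ k`, right exactness of `- ⊗ C` lets it factor through `- ⊗
k`; full faithfulness brings the factorisation back to modules. -/
lemma IsCopresentedBy.comp_map_eq_zero_iff {F : TFP Rᵐᵒᵖ} {A B : LeftMod R} {k : A ⟶ B}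
    {j : F.obj ⟶ (tensor R).obj A} (h : IsCopresentedBy F.obj k j) (hA : isFPModule R A)
    (hB : isFPModule R B) {C : LeftMod R} (c : A ⟶ C) :
    j ≫ (tensor R).map c = 0 ↔ ∃ d : B ⟶ C, k ≫ d = c := by
  constructor
  · intro hc
    obtain ⟨P, Q, -, -, -, -, g, y, hy⟩ := exists_presents_tensor hA
    obtain ⟨P', Q', -, -, -, -, g', y', hy'⟩ := exists_presents_tensor hB
    obtain ⟨τ, hτ⟩ := hy.exists_extension hy' (isRightExact_tensor C) ((tensor R).map k)
      ((tensor R).map c) fun M z hz => by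
        obtain ⟨w, rfl⟩ := (h.exactSeq M z).1 hz
        exact ConcreteCategory.congr_hom (NatTrans.congr_app hc M) w
    obtain ⟨d, rfl⟩ := exists_tensor_map_eq τ
    exact ⟨d, tensor_map_injective (by rw [Functor.map_comp, hτ])⟩
  · rintro ⟨d, rfl⟩
    rw [Functor.map_comp, ← Category.assoc, h.comp_eq_zero, zero_comp]

/-- The functor `- ⊗ A` as an object of `fp(Mod(R), Ab)`. -/
def tensorFP {A : LeftMod R} (hA : isFPModule R A) : FP (RightMod R) :=
  ⟨(tensor R).obj A, isTFP_le_isFP _ _ (isTFP_tensor hA)⟩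

lemma injective_tensorFP {A : LeftMod R} (hA : isFPModule R A) : Injective (tensorFP hA) := by
  obtain ⟨P, Q, -, -, hP, hQ, f, x, h⟩ := exists_presents_tensor hA
  exact injective_of_presents (tensorFP hA) h

end Copresentations

/-! ### The zeroth left derived functor as a cokernel. -/

section DerivedFunctor

variable {C : Type*} [Category* C] [Abelian C] [EnoughProjectives C]
  {D : Type*} [Category* D] [Abelian D]

section

variable {X P₀ P₁ : C} (d : P₁ ⟶ P₀) (p : P₀ ⟶ X)

/-- The next step of a projective resolution. -/
def resolutionSucc {X₀ X₁ : C} (f : X₁ ⟶ X₀) : Σ' (X₂ : C) (d : X₂ ⟶ X₁), d ≫ f = 0 :=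
  ⟨Projective.syzygies f, Projective.d f, (Category.assoc _ _ _).trans
    ((congrArg (Projective.π (kernel f) ≫ ·) (kernel.condition f)).trans comp_zero)⟩

/-- The complex of projective objects continuing a map `P₁ ⟶ P₀`. -/
def resolutionComplex : ChainComplex C ℕ := ChainComplex.mk' P₀ P₁ d resolutionSucc

lemma resolutionComplex_d_one_zero : (resolutionComplex d).d 1 0 = d :=
  ChainComplex.mk'_d_1_0 _ _ _ _

lemma resolutionComplex_exactAt_succ (n : ℕ) : (resolutionComplex d).ExactAt (n + 1) := by
  rw [HomologicalComplex.exactAt_iff' _ (n + 2) (n + 1) n (by simp) (by simp)]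
  let e : (resolutionComplex d).sc' (n + 2) (n + 1) n ≅
      ShortComplex.mk (Projective.d ((resolutionComplex d).d (n + 1) n))
        ((resolutionComplex d).d (n + 1) n) (resolutionSucc _).2.2 :=
    ShortComplex.isoMk (ChainComplex.mk'XIso P₀ P₁ d resolutionSucc n) (Iso.refl _) (Iso.refl _)
      ((ChainComplex.mk'_d P₀ P₁ d resolutionSucc n).symm.trans (Category.comp_id _).symm)
      ((Category.id_comp _).trans (Category.comp_id _).symm)
  exact ShortComplex.exact_of_iso e.symm (exact_d_f _)

instance [Projective P₀] [Projective P₁] (n : ℕ) : Projective ((resolutionComplex d).X n) := by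
  obtain _ | _ | n := n
  · exact inferInstanceAs (Projective P₀)
  · exact inferInstanceAs (Projective P₁)
  · exact Projective.of_iso (ChainComplex.mk'XIso P₀ P₁ d resolutionSucc n).symm
      (inferInstanceAs (Projective (Projective.syzygies ((resolutionComplex d).d (n + 1) n))))

variable {d p}

/-- The augmentation of the complex continuing an exact sequence. -/
def resolutionAugmentation (w : d ≫ p = 0) :
    resolutionComplex d ⟶ (ChainComplex.single₀ C).obj X :=
  (ChainComplex.toSingle₀Equiv _ _).symm
    ⟨p, (congrArg (· ≫ p) (resolutionComplex_d_one_zero d)).trans w⟩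

lemma resolutionAugmentation_f_zero (w : d ≫ p = 0) : (resolutionAugmentation w).f 0 = p :=
  ChainComplex.toSingle₀Equiv_symm_apply_f_zero _ _

/-- The projective resolution continuing an exact sequence `P₁ ⟶ P₀ ⟶ X ⟶ 0`. -/
def resolutionOfExact [Projective P₀] [Projective P₁] [Epi p] {w : d ≫ p = 0}
    (hex : (ShortComplex.mk d p w).Exact) : ProjectiveResolution X where
  complex := resolutionComplex d
  π := resolutionAugmentation w
  quasiIso := ⟨fun n => by
    cases n
    · rw [ChainComplex.quasiIsoAt₀_iff, ShortComplex.quasiIso_iff_of_zeros']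
      · refine (ShortComplex.exact_and_epi_g_iff_of_iso ?_).2 ⟨hex, ‹Epi p›⟩
        refine ShortComplex.isoMk (Iso.refl _) (Iso.refl _) (Iso.refl _) ?_ ?_
        · exact (Category.id_comp _).trans
            ((resolutionComplex_d_one_zero d).symm.trans (Category.comp_id _).symm)
        · exact (Category.id_comp _).trans
            ((resolutionAugmentation_f_zero w).symm.trans (Category.comp_id _).symm)
      all_goals rfl
    · rw [quasiIsoAt_iff_exactAt']
      · apply resolutionComplex_exactAt_succ
      · apply ChainComplex.exactAt_succ_single_obj⟩

end

variable (Φ : C ⥤ D) [Φ.Additive]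

/-- The zeroth left derived functor as the homology of a projective resolution. -/
def homologyIsoLeftDerivedZero {X : C} (P : ProjectiveResolution X) :
    ((Φ.mapHomologicalComplex _).obj P.complex).homology 0 ≅ (Φ.leftDerived 0).obj X :=
  (P.isoLeftDerivedObj Φ 0).symm

/-- The zeroth left derived functor as a cokernel in a projective resolution. -/
def opcyclesIsoLeftDerivedZero {X : C} (P : ProjectiveResolution X) :
    ((Φ.mapHomologicalComplex _).obj P.complex).opcycles 0 ≅ (Φ.leftDerived 0).obj X :=
  (ChainComplex.isoHomologyι₀ _).symm ≪≫ homologyIsoLeftDerivedZero Φ P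

/-- The map `Φ P₀ ⟶ L₀Φ X` for a projective resolution `P` of `X`. -/
def toLeftDerivedZero {X : C} (P : ProjectiveResolution X) :
    ((Φ.mapHomologicalComplex _).obj P.complex).X 0 ⟶ (Φ.leftDerived 0).obj X :=
  ((Φ.mapHomologicalComplex _).obj P.complex).pOpcycles 0 ≫ (opcyclesIsoLeftDerivedZero Φ P).hom

lemma toLeftDerivedZero_naturality {X Y : C} (f : X ⟶ Y) (P : ProjectiveResolution X)
    (Q : ProjectiveResolution Y) (φ : P.complex ⟶ Q.complex)
    (comm : φ.f 0 ≫ Q.π.f 0 = P.π.f 0 ≫ f) :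
    toLeftDerivedZero Φ P ≫ (Φ.leftDerived 0).map f =
      ((Φ.mapHomologicalComplex _).map φ).f 0 ≫ toLeftDerivedZero Φ Q := by
  have h1 : (homologyIsoLeftDerivedZero Φ P).hom ≫ (Φ.leftDerived 0).map f =
    HomologicalComplex.homologyMap ((Φ.mapHomologicalComplex _).map φ) 0 ≫
      (homologyIsoLeftDerivedZero Φ Q).hom := P.isoLeftDerivedObj_inv_naturality f Q φ comm Φ 0
  have h2 := ChainComplex.isoHomologyι₀_inv_naturality ((Φ.mapHomologicalComplex _).map φ)
  have h3 := HomologicalComplex.p_opcyclesMap ((Φ.mapHomologicalComplex _).map φ) 0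
  simp only [toLeftDerivedZero, opcyclesIsoLeftDerivedZero, Iso.trans_hom, Iso.symm_hom,
    Category.assoc, h1]
  rw [reassoc_of% h2, reassoc_of% h3]

lemma toLeftDerivedZero_comp {X : C} (P : ProjectiveResolution X) :
    ((Φ.mapHomologicalComplex _).obj P.complex).d 1 0 ≫ toLeftDerivedZero Φ P = 0 := by
  rw [toLeftDerivedZero, HomologicalComplex.d_pOpcycles_assoc, zero_comp]

lemma epi_toLeftDerivedZero {X : C} (P : ProjectiveResolution X) :
    Epi (toLeftDerivedZero Φ P) := by
  unfold toLeftDerivedZero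
  infer_instance

/-- In degree zero the homology of the complex is its object of opcycles, which is the cokernel of
the image of the first differential. -/
lemma toLeftDerivedZero_exact {X : C} (P : ProjectiveResolution X) :
    (ShortComplex.mk _ _ (toLeftDerivedZero_comp Φ P)).Exact := by
  have h := ShortComplex.exact_of_g_is_cokernel
    (ShortComplex.mk _ _ (((Φ.mapHomologicalComplex _).obj P.complex).d_pOpcycles 1 0))
    (HomologicalComplex.opcyclesIsCokernel _ 1 0 (by simp))
  let e : ShortComplex.mk _ _ (((Φ.mapHomologicalComplex _).obj P.complex).d_pOpcycles 1 0) ≅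
      ShortComplex.mk _ _ (toLeftDerivedZero_comp Φ P) :=
    ShortComplex.isoMk (Iso.refl _) (Iso.refl _) (opcyclesIsoLeftDerivedZero Φ P)
      ((Category.id_comp _).trans (Category.comp_id _).symm) (Category.id_comp _)
  exact ShortComplex.exact_of_iso e h

end DerivedFunctor

/-! ### The derived functor computed from a copresentation. -/

section DualFunctor

/-- Right exact sequences of finitely presented functors are exact at every object. -/
lemma FP.exactSeq_of_exact {C : Type u} [Category.{v} C] [Abelian C] (S : ShortComplex (FP C))
    (hS : S.Exact) [Epi S.g] :
    ExactSeq S.f.hom S.g.hom ∧ ∀ A, Function.Surjective (S.g.hom.app A) := by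
  have := (isFP (C := C)).preservesCokernels_ι
  have := (isFP (C := C)).preservesEpimorphisms_ι_of_isNormalMonoCategory
  have hepi : Epi S.g.hom := inferInstanceAs (Epi ((isFP (C := C)).ι.map S.g))
  refine ⟨?_, fun A => (AddCommGrpCat.epi_iff_surjective _).1 inferInstance⟩
  exact exact_app (hS.map_of_epi_of_preservesCokernel (isFP (C := C)).ι inferInstance inferInstance)

variable {R : Type u} [Ring R]

/-- The value at `R` of `- ⊗ A` is `A`. -/
def evTensorIso {A : LeftMod R} (hA : isFPModule R A) : (ev R).obj (tensorFP hA) ≅ A :=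
  let e : ((ev R).obj (tensorFP hA) : LeftMod R) ≃ₗ[R] A :=
    { toFun := tensorMul A
      map_add' := map_add (tensorMul A)
      map_smul' := fun r t => tensorMul_map_leftMul r t
      invFun := fun a => tens (M := regular R) (1 : R) a
      left_inv := one_tens_tensorMul
      right_inv := fun a => one_smul R a }
  e.toModuleIso

lemma evTensorIso_naturality {A B : LeftMod R} (hA : isFPModule R A) (hB : isFPModule R B)
    (b : A ⟶ B) (τ : tensorFP hA ⟶ tensorFP hB) (hτ : τ.hom = (tensor R).map b) :
    (ev R).map τ ≫ (evTensorIso hB).hom = (evTensorIso hA).hom ≫ b := by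
  ext t
  change tensorMul B (τ.hom.app (regular R) t) = b (tensorMul A t)
  rw [hτ]
  have : (tensorMul B).comp (((tensor R).map b).app (regular R)).hom =
      b.hom.toAddMonoidHom.comp (tensorMul A) :=
    tensorObj_hom_ext fun m a => (map_smul b.hom m a).symm
  exact DFunLike.congr_fun this t

variable (R) in
/-- The restriction of the derived functor to totally finitely presented functors. -/
abbrev restrictedDual : (TFP Rᵐᵒᵖ)ᵒᵖ ⥤ LeftMod R ⥤ AddCommGrpCat.{u} :=
  (tfpToFP Rᵐᵒᵖ).op ⋙ dualFunctor R ⋙ isFP.ι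

/-- A copresentation of a functor by tensor product functors. -/
structure Copresentation (F : TFP Rᵐᵒᵖ) where
  /-- the source -/
  A : LeftMod R
  /-- the target -/
  B : LeftMod R
  hA : isFPModule R A
  hB : isFPModule R B
  /-- the map -/
  k : A ⟶ B
  /-- the embedding -/
  j : F.obj ⟶ (tensor R).obj A
  isCopresentedBy : IsCopresentedBy F.obj k j

lemma nonempty_copresentation (F : TFP Rᵐᵒᵖ) : Nonempty (Copresentation F) := by
  obtain ⟨A, B, hA, hB, k, j, h⟩ := exists_isCopresentedBy F
  exact ⟨⟨A, B, hA, hB, k, j, h⟩⟩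

namespace Copresentation

variable {F G : TFP Rᵐᵒᵖ} (c : Copresentation F)

/-- The embedding, in `fp(Mod(R), Ab)`. -/
def jFP : (tfpToFP Rᵐᵒᵖ).obj F ⟶ tensorFP c.hA := ObjectProperty.homMk c.j

/-- The map of tensor product functors, in `fp(Mod(R), Ab)`. -/
def kFP : tensorFP c.hA ⟶ tensorFP c.hB := ObjectProperty.homMk ((tensor R).map c.k)

instance : Mono c.jFP := by
  have := c.isCopresentedBy.mono
  exact (isFP (C := RightMod R)).ι.mono_of_mono_map this

lemma jFP_kFP : c.jFP ≫ c.kFP = 0 := by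
  ext1
  exact c.isCopresentedBy.comp_eq_zero

lemma exact : (ShortComplex.mk c.jFP c.kFP c.jFP_kFP).Exact := by
  refine ShortComplex.exact_of_f_is_kernel _ (KernelFork.IsLimit.ofι' _ _ fun {G} m hm => ?_)
  have h := c.isCopresentedBy.exists_lift m.hom (congrArg (fun τ => τ.hom) hm)
  exact ⟨ObjectProperty.homMk h.choose, by ext1; exact h.choose_spec⟩

instance : Epi c.jFP.op := inferInstance

lemma exact_op : (ShortComplex.mk c.kFP.op c.jFP.op (by rw [← op_comp, c.jFP_kFP]; rfl)).Exact :=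
  c.exact.op

/-- The injective copresentation, as a projective resolution in the opposite category. -/
def resolution : ProjectiveResolution (op ((tfpToFP Rᵐᵒᵖ).obj F)) :=
  have := injective_tensorFP c.hA
  have := injective_tensorFP c.hB
  resolutionOfExact c.exact_op

/-- The map `(A, -) ⟶ DF`. -/
def toDual : repFP.obj (op ((ev R).obj (tensorFP c.hA))) ⟶
    (dualFunctor R).obj (op ((tfpToFP Rᵐᵒᵖ).obj F)) :=
  toLeftDerivedZero (yonedaEv R) c.resolution

/-- The element of `DF(A)` corresponding to the embedding. -/
def elt : ((restrictedDual R).obj (op F)).obj c.A :=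
  ((restrictedDual R).obj (op F)).map (evTensorIso c.hA).hom
    (c.toDual.hom.app _ (𝟙 ((ev R).obj (tensorFP c.hA))))

/-- The derived functor is the cokernel of the map that `Y_R` makes of `- ⊗ k`; as evaluation of `-
⊗ A` at `R` gives back `A`, this is the map `(B, -) ⟶ (A, -)` induced by `k`. -/
lemma presents : Presents ((restrictedDual R).obj (op F)) c.k c.elt := by
  have : Epi c.toDual := epi_toLeftDerivedZero (yonedaEv R) c.resolution
  have hd : (((yonedaEv R).mapHomologicalComplex _).obj c.resolution.complex).d 1 0 =
      repFP.map ((ev R).map c.kFP).op :=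
    congrArg (yonedaEv R).map (resolutionComplex_d_one_zero c.kFP.op)
  have hz : repFP.map ((ev R).map c.kFP).op ≫ c.toDual = 0 := by
    rw [← hd]
    exact toLeftDerivedZero_comp (yonedaEv R) c.resolution
  have hex : (ShortComplex.mk _ _ hz).Exact := by
    refine ShortComplex.exact_of_iso (ShortComplex.isoMk (Iso.refl _) (Iso.refl _) (Iso.refl _)
      ?_ ?_) (toLeftDerivedZero_exact (yonedaEv R) c.resolution)
    · exact (Category.id_comp _).trans (hd.symm.trans (Category.comp_id _).symm)
    · exact (Category.id_comp _).trans (Category.comp_id _).symm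
  obtain ⟨h1, h2⟩ := FP.exactSeq_of_exact (ShortComplex.mk _ _ hz) hex
  have h3 := presents_of_exactSeq ((ev R).map c.kFP) c.toDual.hom h1 h2
  exact h3.congr_iso (evTensorIso c.hA) (evTensorIso c.hB)
    (evTensorIso_naturality c.hA c.hB c.k c.kFP rfl)

lemma resolution_π : c.resolution.π.f 0 = c.jFP.op :=
  ChainComplex.toSingle₀Equiv_symm_apply_f_zero _ _

/-- A lift of `α` to the injective copresentations has the form `- ⊗ b`, and the derived functor
acts through that lift. Following the identity of `d.A` through the naturality square gives the
action of `α` on generators. -/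
lemma exists_map_elt (d : Copresentation G) (α : F ⟶ G) : ∃ b : c.A ⟶ d.A,
    c.j ≫ (tensor R).map b = α.hom ≫ d.j ∧
    ((restrictedDual R).map α.op).app d.A d.elt =
      ((restrictedDual R).obj (op F)).map b c.elt := by
  let f := ((tfpToFP Rᵐᵒᵖ).map α).op
  let φ := ProjectiveResolution.lift f d.resolution c.resolution
  have hφ : φ.f 0 ≫ c.resolution.π.f 0 = d.resolution.π.f 0 ≫ f :=
    ProjectiveResolution.lift_commutes_zero _ _ _
  rw [resolution_π, resolution_π] at hφ
  let τ : tensorFP c.hA ⟶ tensorFP d.hA := Quiver.Hom.unop (φ.f 0)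
  have hτ : c.jFP ≫ τ = (tfpToFP Rᵐᵒᵖ).map α ≫ d.jFP := congrArg Quiver.Hom.unop hφ
  obtain ⟨b, hb⟩ := exists_tensor_map_eq τ.hom
  refine ⟨b, ?_, ?_⟩
  · rw [hb]
    exact congrArg (fun m => m.hom) hτ
  have h1 : d.toDual ≫ (dualFunctor R).map f = repFP.map ((ev R).map τ).op ≫ c.toDual :=
    toLeftDerivedZero_naturality (yonedaEv R) f d.resolution c.resolution φ
      (ProjectiveResolution.lift_commutes_zero _ _ _)
  have h2 : ((restrictedDual R).map α.op).app _
        (d.toDual.hom.app _ (𝟙 ((ev R).obj (tensorFP d.hA)))) =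
      ((restrictedDual R).obj (op F)).map ((ev R).map τ)
        (c.toDual.hom.app _ (𝟙 ((ev R).obj (tensorFP c.hA)))) := by
    have h3 := ConcreteCategory.congr_hom
      (NatTrans.congr_app (congrArg (fun m => m.hom) h1) ((ev R).obj (tensorFP d.hA)))
      (𝟙 ((ev R).obj (tensorFP d.hA)))
    refine h3.trans (Eq.trans ?_ (rep_hom_apply c.toDual.hom ((ev R).map τ)))
    exact congrArg (c.toDual.hom.app _) (Category.comp_id ((ev R).map τ))
  rw [elt, elt, nat_apply, h2, ← map_comp_apply', ← map_comp_apply',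
    evTensorIso_naturality c.hA d.hA b τ hb.symm]

end Copresentation

end DualFunctor

/-! ### Comparison of the derived functor with `Nat(F, - ⊗ A)`. -/

section TensorDual

variable {R : Type u} [Ring R]

lemma tensor_map_add {A B : LeftMod R} (f g : A ⟶ B) :
    (tensor R).map (f + g) = (tensor R).map f + (tensor R).map g :=
  tensor_natTrans_ext fun a => tens_add (M := regular R) (1 : R) (f a) (g a)

/-- The functor `A ↦ Nat(F, - ⊗ A)` is `N`. -/
structure RepresentsDual (F : TFP Rᵐᵒᵖ) (N : LeftMod R ⥤ AddCommGrpCat.{u}) where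
  /-- the isomorphisms -/
  equiv : ∀ A : LeftMod R, N.obj A ≃+ (F.obj ⟶ (tensor R).obj A)
  equiv_map : ∀ {A B : LeftMod R} (g : A ⟶ B) (x : N.obj A),
    equiv B (N.map g x) = equiv A x ≫ (tensor R).map g

/-- Transformations `F ⟶ - ⊗ C` extend along `j` to maps `A ⟶ C`, and the extension restricts to
zero exactly when it factors through `k`. This is the presentation that the derived functor has. -/
lemma RepresentsDual.presents {F : TFP Rᵐᵒᵖ} {N : LeftMod R ⥤ AddCommGrpCat.{u}}
    (e : RepresentsDual F N) {A B : LeftMod R} (hA : isFPModule R A) (hB : isFPModule R B)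
    {k : A ⟶ B} {j : F.obj ⟶ (tensor R).obj A} (h : IsCopresentedBy F.obj k j) :
    Presents N k ((e.equiv A).symm j) where
  gen C z := by
    obtain ⟨c, hc⟩ := h.exists_extension hA (e.equiv C z)
    refine ⟨c, (e.equiv C).injective ?_⟩
    rw [e.equiv_map, AddEquiv.apply_symm_apply, hc]
  rel C c := by
    rw [← (e.equiv C).map_eq_zero_iff, e.equiv_map, AddEquiv.apply_symm_apply,
      h.comp_map_eq_zero_iff hA hB]

lemma RepresentsDual.additive {F : TFP Rᵐᵒᵖ} {N : LeftMod R ⥤ AddCommGrpCat.{u}}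
    (e : RepresentsDual F N) : N.Additive where
  map_add {A B f g} := by
    ext x
    apply (e.equiv B).injective
    change e.equiv B (N.map (f + g) x) = e.equiv B (N.map f x + N.map g x)
    rw [map_add, e.equiv_map, e.equiv_map, e.equiv_map, tensor_map_add, Preadditive.comp_add]

/-- A priori these transformations form a type in a larger universe, but extension along a
copresentation makes them a quotient of the maps `c.A ⟶ A`. -/
instance (F : TFP Rᵐᵒᵖ) (A : LeftMod R) : Small.{u} (F.obj ⟶ (tensor R).obj A) := by
  obtain ⟨c⟩ := nonempty_copresentation F
  exact small_of_surjective (f := fun b : c.A ⟶ A => c.j ≫ (tensor R).map b)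
    fun m => c.isCopresentedBy.exists_extension c.hA m

/-- A model of the functor `A ↦ Nat(F, - ⊗ A)`. -/
def tensorDual (F : TFP Rᵐᵒᵖ) : LeftMod R ⥤ AddCommGrpCat.{u} where
  obj A := AddCommGrpCat.of (Shrink.{u} (F.obj ⟶ (tensor R).obj A))
  map {A B} g := AddCommGrpCat.ofHom <|
    (Shrink.addEquiv.symm.toAddMonoidHom.comp (Preadditive.rightComp F.obj ((tensor R).map g))).comp
      (Shrink.addEquiv (α := F.obj ⟶ (tensor R).obj A)).toAddMonoidHom
  map_id A := by
    refine AddCommGrpCat.hom_ext (AddMonoidHom.ext fun x => ?_)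
    let s := Shrink.addEquiv.{u} (α := F.obj ⟶ (tensor R).obj A)
    apply s.injective
    change s (s.symm (s x ≫ (tensor R).map (𝟙 A))) = s x
    rw [s.apply_symm_apply, CategoryTheory.Functor.map_id, Category.comp_id]
  map_comp {A B C} f g := by
    refine AddCommGrpCat.hom_ext (AddMonoidHom.ext fun x => ?_)
    let s (A : LeftMod R) := Shrink.addEquiv.{u} (α := F.obj ⟶ (tensor R).obj A)
    apply (s C).injective
    change s C ((s C).symm (s A x ≫ (tensor R).map (f ≫ g))) =
      s C ((s C).symm (s B ((s B).symm (s A x ≫ (tensor R).map f)) ≫ (tensor R).map g))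
    rw [(s C).apply_symm_apply, (s C).apply_symm_apply, (s B).apply_symm_apply, Functor.map_comp,
      Category.assoc]

/-- The model represents the dual. -/
def tensorDualRepresents (F : TFP Rᵐᵒᵖ) : RepresentsDual F (tensorDual F) where
  equiv A := Shrink.addEquiv (α := F.obj ⟶ (tensor R).obj A)
  equiv_map _ _ := (Shrink.addEquiv (α := F.obj ⟶ (tensor R).obj _)).apply_symm_apply _

/-- A contravariant functor `D` with natural isomorphisms `DF(A) ≅ Nat(F, - ⊗ A)`. -/
structure TensorDuality (D : (TFP Rᵐᵒᵖ)ᵒᵖ ⥤ LeftMod R ⥤ AddCommGrpCat.{u}) where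
  /-- the isomorphisms -/
  represents : ∀ F : TFP Rᵐᵒᵖ, RepresentsDual F (D.obj (op F))
  map_left : ∀ {F G : TFP Rᵐᵒᵖ} (α : F ⟶ G) (A : LeftMod R) (x : (D.obj (op G)).obj A),
    (represents F).equiv A ((D.map α.op).app A x) = α.hom ≫ (represents G).equiv A x

instance (F : TFP Rᵐᵒᵖ) : ((restrictedDual R).obj (op F)).Additive :=
  ((isFP_iff _).1 ((dualFunctor R).obj (op ((tfpToFP Rᵐᵒᵖ).obj F))).property).1

lemma isTFP_restrictedDual (F : TFP Rᵐᵒᵖ) : isTFP R ((restrictedDual R).obj (op F)) := by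
  obtain ⟨c⟩ := nonempty_copresentation F
  exact c.presents.hasPresentation c.hA c.hB

/-- Both functors are presented by `c.k`, so they are isomorphic by a map matching the generators
`c.elt` and `c.j`. -/
lemma Copresentation.exists_represents {F : TFP Rᵐᵒᵖ} (c : Copresentation F) :
    ∃ e : RepresentsDual F ((restrictedDual R).obj (op F)), e.equiv c.A c.elt = c.j := by
  let s := tensorDualRepresents F
  have := s.additive
  obtain ⟨i, hi⟩ := c.presents.exists_iso (s.presents c.hA c.hB c.isCopresentedBy)
  refine ⟨{ equiv := fun A => (i.app A).addCommGroupIsoToAddEquiv.trans (s.equiv A)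
            equiv_map := fun {A B} g x => ?_ }, ?_⟩
  · change s.equiv B (i.hom.app B _) = s.equiv A (i.hom.app A x) ≫ _
    rw [nat_apply, s.equiv_map]
  · change s.equiv c.A (i.hom.app c.A c.elt) = c.j
    rw [hi, AddEquiv.apply_symm_apply]

variable (R) in
/-- The derived functor is the functor `F ↦ Nat(F, - ⊗ A)`. -/
def dualTensorDuality : TensorDuality (restrictedDual R) :=
  let c (F : TFP Rᵐᵒᵖ) := (nonempty_copresentation F).some
  { represents := fun F => (c F).exists_represents.choose
    map_left := fun {F G} α A x => by
      have hF := (c F).exists_represents.choose_spec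
      have hG := (c G).exists_represents.choose_spec
      obtain ⟨b, hb, hb'⟩ := (c F).exists_map_elt (c G) α
      -- As the generator of `DG` reaches every element, naturality in the functor need only be
      -- checked there, where it is the commutation of `b` with the two embeddings.
      obtain ⟨h, rfl⟩ := (c G).presents.gen A x
      rw [nat_apply, hb', RepresentsDual.equiv_map, RepresentsDual.equiv_map,
        RepresentsDual.equiv_map, hF, hG, hb, Category.assoc] }

end TensorDual

/-! ### Consequences of `DF(A) ≅ Nat(F, - ⊗ A)`. -/

section Properties

variable {R : Type u} [Ring R]

/-- Functors representing the dual of the same functor are isomorphic. -/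
def RepresentsDual.iso {F : TFP Rᵐᵒᵖ} {N N' : LeftMod R ⥤ AddCommGrpCat.{u}}
    (e : RepresentsDual F N) (e' : RepresentsDual F N') : N ≅ N' :=
  NatIso.ofComponents (fun A => ((e.equiv A).trans (e'.equiv A).symm).toAddCommGrpIso) <| by
    intro A B g
    ext x
    change (e'.equiv B).symm (e.equiv B (N.map g x)) = N'.map g ((e'.equiv A).symm (e.equiv A x))
    rw [AddEquiv.symm_apply_eq, e'.equiv_map, AddEquiv.apply_symm_apply, e.equiv_map]

lemma RepresentsDual.equiv_iso_inv {F : TFP Rᵐᵒᵖ} {N N' : LeftMod R ⥤ AddCommGrpCat.{u}}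
    (e : RepresentsDual F N) (e' : RepresentsDual F N') {A : LeftMod R} (x : N'.obj A) :
    e.equiv A ((e.iso e').inv.app A x) = e'.equiv A x :=
  (e.equiv A).apply_symm_apply _

namespace TensorDuality

section

variable {D : (TFP Rᵐᵒᵖ)ᵒᵖ ⥤ LeftMod R ⥤ AddCommGrpCat.{u}} (T : TensorDuality D)

/-- The isomorphism `DF(A) ≅ Nat(F, - ⊗ A)`. -/
abbrev e (F : TFP Rᵐᵒᵖ) (A : LeftMod R) : (D.obj (op F)).obj A ≃+ (F.obj ⟶ (tensor R).obj A) :=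
  (T.represents F).equiv A

/-- A map `G ⟶ - ⊗ A` that vanishes on the image of `α` vanishes on the kernel of `β`, so it extends
along `β` because `- ⊗ A` is right exact. -/
lemma exactSeq_map (T : TensorDuality D) {F G H : TFP Rᵐᵒᵖ} (α : F ⟶ G) (β : G ⟶ H) (h : ExactSeq α.hom β.hom) :
    ExactSeq (D.map β.op) (D.map α.op) := by
  intro A x
  constructor
  · intro hx
    have h1 : α.hom ≫ T.e G A x = 0 := by rw [← T.map_left, hx, map_zero]
    obtain ⟨-, _, _, -, -, _, _, hG⟩ := HasPresentation.exists_presents G.property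
    obtain ⟨-, _, _, -, -, _, _, hH⟩ := HasPresentation.exists_presents H.property
    obtain ⟨η, hη⟩ := hG.exists_extension hH (isRightExact_tensor A) β.hom (T.e G A x) <| by
      intro M z hz
      obtain ⟨y, rfl⟩ := (h M z).1 hz
      exact ConcreteCategory.congr_hom (NatTrans.congr_app h1 M) y
    refine ⟨(T.e H A).symm η, (T.e G A).injective ?_⟩
    rw [T.map_left, AddEquiv.apply_symm_apply, hη]
  · rintro ⟨y, rfl⟩
    apply (T.e F A).injective
    rw [T.map_left, T.map_left, map_zero]
    ext M z
    exact (congrArg ((T.e H A y).app M) ((h M _).2 ⟨z, rfl⟩)).trans (map_zero _)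

/-- Transformations from a totally finitely presented functor to `- ⊗ A` are determined on
finitely presented modules, where they may be prescribed. -/
lemma bijective_whiskerLeft (F : TFP Rᵐᵒᵖ) (A : LeftMod R) : Function.Bijective
    fun x : (D.obj (op F)).obj A => Functor.whiskerLeft (isFPModule Rᵐᵒᵖ).ι (T.e F A x) := by
  -- `X` and `Y` are finitely presented, so the restriction already sees the generator of `F` and
  -- its relation, which together determine the transformations out of `F`.
  obtain ⟨-, X, Y, hX, hY, f, x, hx⟩ := HasPresentation.exists_presents F.property
  refine Function.Bijective.comp (g := fun τ : F.obj ⟶ (tensor R).obj A =>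
    Functor.whiskerLeft (isFPModule Rᵐᵒᵖ).ι τ) ⟨fun σ τ h => ?_, fun σ => ?_⟩ (T.e F A).bijective
  · exact hx.hom_ext (ConcreteCategory.congr_hom (NatTrans.congr_app h ⟨X, hX⟩) x)
  · have hσ : ∀ {P Q : FPMod Rᵐᵒᵖ} (h : P ⟶ Q) (z : F.obj.obj P.obj),
        σ.app Q (F.obj.map h.hom z) = ((tensor R).obj A).map h.hom (σ.app P z) :=
      fun h z => ConcreteCategory.congr_hom (σ.naturality h) z
    obtain ⟨τ, hτ⟩ := hx.exists_hom (G := (tensor R).obj A) (σ.app ⟨X, hX⟩ x) <| by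
      have := hσ (P := ⟨X, hX⟩) (Q := ⟨Y, hY⟩) (ObjectProperty.homMk f) x
      refine this.symm.trans ?_
      exact (congrArg (σ.app ⟨Y, hY⟩) hx.map_eq_zero).trans (map_zero _)
    refine ⟨τ, ?_⟩
    ext P z
    obtain ⟨h, rfl⟩ := hx.gen P.obj z
    change τ.app P.obj _ = _
    rw [nat_apply, hτ]
    exact (hσ (P := ⟨X, hX⟩) (Q := P) (ObjectProperty.homMk h) x).symm

/-- The dual of the functor of a pair of formulas is the functor of the pair of duals. -/
lemma exists_iso_ppPair_dual {n : ℕ} (φ ψ : PPFormula Rᵐᵒᵖ n) (hF : isTFP Rᵐᵒᵖ (ppPair φ ψ)) :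
    ∃ i : D.obj (op ⟨ppPair φ ψ, hF⟩) ≅ ppPair ψ.dual φ.dual,
      ∀ (N : LeftMod R) (b : ψ.dual.sol N),
        T.e ⟨ppPair φ ψ, hF⟩ N (i.inv.app N (ppMk _ _ b)) = pairingHom φ ψ b := by
  let p : RepresentsDual ⟨ppPair φ ψ, hF⟩ (ppPair ψ.dual φ.dual) :=
    ⟨pairingEquiv, pairingEquiv_map⟩
  exact ⟨(T.represents _).iso p, fun N b => RepresentsDual.equiv_iso_inv _ p (ppMk _ _ b)⟩

end

/-! ### The dual is an equivalence. -/

section Equivalence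

variable {D : (TFP Rᵐᵒᵖ)ᵒᵖ ⥤ TFP R}

/-- The element of the dual that corresponds to the embedding `c.j` is sent to `α` followed by
`c.j`, and `c.j` is a monomorphism. -/
lemma faithful (T : TensorDuality (D ⋙ (isTFP R).ι)) : D.Faithful where
  map_injective {G F} α β h := by
    obtain ⟨c⟩ := nonempty_copresentation G.unop
    have := c.isCopresentedBy.mono
    apply Quiver.Hom.unop_inj
    ext1
    rw [← cancel_mono c.j]
    obtain ⟨x, hx⟩ := (T.e G.unop c.A).surjective c.j
    rw [← hx, ← T.map_left, ← T.map_left]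
    change T.e F.unop c.A ((D.map α).hom.app c.A x) = T.e F.unop c.A ((D.map β).hom.app c.A x)
    rw [h]

/-- A map `γ` of duals is determined by its value at the generator, which is a transformation from
`F` to `- ⊗ A`. The relation `k` forces it into the kernel of `- ⊗ k`, that is, into the functor
that `c` copresents. -/
lemma full (T : TensorDuality (D ⋙ (isTFP R).ι)) : D.Full where
  map_surjective {G F} γ := by
    obtain ⟨c⟩ := nonempty_copresentation G.unop
    let γ' : (D ⋙ (isTFP R).ι).obj G ⟶ (D ⋙ (isTFP R).ι).obj F := γ.hom
    let x := (T.e G.unop c.A).symm c.j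
    have hpres := (T.represents G.unop).presents c.hA c.hB c.isCopresentedBy
    obtain ⟨α, hα⟩ := c.isCopresentedBy.exists_lift (T.e F.unop c.A (γ'.app c.A x)) <| by
      rw [← RepresentsDual.equiv_map]
      refine (congrArg _ (nat_apply γ' c.k x).symm).trans ?_
      refine (congrArg (fun t => T.e F.unop c.B (γ'.app c.B t)) hpres.map_eq_zero).trans ?_
      exact (congrArg (T.e F.unop c.B) (map_zero _)).trans (map_zero _)
    refine ⟨(ObjectProperty.homMk α : F.unop ⟶ G.unop).op, ?_⟩
    ext1
    refine hpres.hom_ext (T.e F.unop c.A |>.injective ?_)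
    refine (T.map_left (ObjectProperty.homMk α : F.unop ⟶ G.unop) c.A x).trans ?_
    rw [AddEquiv.apply_symm_apply]
    exact hα

/-- If `H` is presented by `k`, then the kernel of `- ⊗ k` has a dual presented by `k` too. -/
lemma essSurj (T : TensorDuality (D ⋙ (isTFP R).ι)) : D.EssSurj where
  mem_essImage H := by
    obtain ⟨hadd, A, B, hA, hB, k, x, hx⟩ := HasPresentation.exists_presents H.property
    obtain ⟨F, j, h⟩ := exists_isCopresentedBy_of_hom hA hB k
    have := (T.represents F).additive
    obtain ⟨i, -⟩ := ((T.represents F).presents hA hB h).exists_iso hx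
    exact ⟨op F, ⟨(isTFP R).isoMk i⟩⟩

lemma isEquivalence (T : TensorDuality (D ⋙ (isTFP R).ι)) : D.IsEquivalence :=
  { faithful := T.faithful, full := T.full, essSurj := T.essSurj }

end Equivalence

end TensorDuality

end Properties

/-! ### Values on representables, and uniqueness of the duality. -/

section Uniqueness

variable {R : Type u} [Ring R]

/-- The Yoneda lemma. -/
def repHomEquiv {C : Type u} [Category.{v} C] [Abelian C] (X : C) (G : C ⥤ AddCommGrpCat.{v})
    [G.Additive] : (rep X ⟶ G) ≃+ G.obj X :=
  AddEquiv.ofBijective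
    (AddMonoidHom.mk' (fun τ : rep X ⟶ G => τ.app X (𝟙 X : X ⟶ X)) fun _ _ => rfl)
    ⟨fun _ _ h => (rep_presents_id X).hom_ext h,
      fun x => (rep_presents_id X).exists_hom x (map_zero_apply G x)⟩

/-- The dual of `(X, -)` is `X ⊗ -`. -/
def TensorDuality.repIso {D : (TFP Rᵐᵒᵖ)ᵒᵖ ⥤ LeftMod R ⥤ AddCommGrpCat.{u}}
    (T : TensorDuality D) :
    (repTFP Rᵐᵒᵖ).rightOp ⋙ D ≅ (isFPModule Rᵐᵒᵖ).ι ⋙ (tensor R).flip :=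
  NatIso.ofComponents (fun X => NatIso.ofComponents (fun A =>
      ((T.e ((repTFP Rᵐᵒᵖ).obj (op X)) A).trans
        (repHomEquiv X.obj ((tensor R).obj A))).toAddCommGrpIso) <| by
    intro A B g
    ext x
    exact congrArg (repHomEquiv X.obj ((tensor R).obj B))
      ((T.represents ((repTFP Rᵐᵒᵖ).obj (op X))).equiv_map g x)) <| by
  intro X Y f
  ext A x
  refine (congrArg (repHomEquiv Y.obj ((tensor R).obj A))
    (T.map_left ((repTFP Rᵐᵒᵖ).map f.op) A x)).trans ?_
  let τ := T.e ((repTFP Rᵐᵒᵖ).obj (op X)) A x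
  change τ.app Y.obj (f.hom ≫ 𝟙 Y.obj) = ((tensor R).obj A).map f.hom (τ.app X.obj (𝟙 X.obj))
  rw [Category.comp_id]
  exact rep_hom_apply τ f.hom

/-- The functor `D` carries `(Y, -) ⟶ (X, -) ⟶ F ⟶ 0` to an exact sequence
`0 ⟶ DF ⟶ X ⊗ - ⟶ Y ⊗ -`. -/
lemma TensorDuality.exactSeq_repIso {D : (TFP Rᵐᵒᵖ)ᵒᵖ ⥤ LeftMod R ⥤ AddCommGrpCat.{u}}
    (T : TensorDuality D) (F : TFP Rᵐᵒᵖ) (X Y : FPMod Rᵐᵒᵖ) (f : X ⟶ Y)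
    (π : (repTFP Rᵐᵒᵖ).obj (op X) ⟶ F) (hex : ExactSeq ((repTFP Rᵐᵒᵖ).map f.op).hom π.hom)
    (hsurj : ∀ M, Function.Surjective (π.hom.app M)) :
    (∀ A, Function.Injective ((D.map π.op ≫ T.repIso.hom.app X).app A)) ∧
      ExactSeq (D.map π.op ≫ T.repIso.hom.app X) ((tensor R).flip.map f.hom) := by
  let π' : rep X.obj ⟶ F.obj := π.hom
  have hp : Presents F.obj f.hom (π'.app X.obj (𝟙 X.obj : X.obj ⟶ X.obj)) :=
    presents_of_exactSeq f.hom π' hex hsurj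
  -- Through `e` and Yoneda, the map `DF ⟶ X ⊗ -` evaluates a transformation at the generator of
  -- `F`. Such a value is arbitrary subject to being killed by `f`.
  have key : ∀ (A : LeftMod R) (x : (D.obj (op F)).obj A),
      (D.map π.op ≫ T.repIso.hom.app X).app A x =
        (T.e F A x).app X.obj (π'.app X.obj (𝟙 X.obj : X.obj ⟶ X.obj)) := fun A x =>
    congrArg (repHomEquiv X.obj ((tensor R).obj A)) (T.map_left π A x)
  refine ⟨fun A x y h => ?_, fun A t => ⟨fun ht => ?_, ?_⟩⟩
  · rw [key, key] at h
    exact (T.e F A).injective (hp.hom_ext h)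
  · obtain ⟨τ, hτ⟩ := hp.exists_hom (G := (tensor R).obj A) t ht
    refine ⟨(T.e F A).symm τ, ?_⟩
    rw [key, AddEquiv.apply_symm_apply, hτ]
  · rintro ⟨x, rfl⟩
    rw [key]
    change ((tensor R).obj A).map f.hom _ = 0
    rw [← nat_apply, hp.map_eq_zero, map_zero]

section ExactFunctors

variable {S : Type u} [Ring S]

/-- A presentation of a totally finitely presented functor by representable functors. -/
structure RepPresentation (F : TFP S) where
  /-- the module of generators -/
  X : FPMod S
  /-- the module of relations -/
  Y : FPMod S
  /-- the map -/
  f : X ⟶ Y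
  /-- the projection -/
  π : (repTFP S).obj (op X) ⟶ F
  exactSeq : ExactSeq ((repTFP S).map f.op).hom π.hom
  surjective : ∀ A, Function.Surjective (π.hom.app A)

lemma nonempty_repPresentation (F : TFP S) : Nonempty (RepPresentation F) := by
  obtain ⟨hadd, X, Y, hX, hY, f, x, hx⟩ := HasPresentation.exists_presents F.property
  obtain ⟨π, -, h1, h2⟩ := hx.exists_rep_hom
  exact ⟨⟨⟨X, hX⟩, ⟨Y, hY⟩, ObjectProperty.homMk f, ObjectProperty.homMk π, h1, h2⟩⟩

/-- By Yoneda, representable functors are projective with respect to surjections of functors. -/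
lemma RepPresentation.exists_lift {F G : TFP S} (p : RepPresentation F) (q : RepPresentation G)
    (α : F ⟶ G) : ∃ a : q.X ⟶ p.X, (repTFP S).map a.op ≫ q.π = p.π ≫ α := by
  let p' : rep p.X.obj ⟶ F.obj := p.π.hom
  let q' : rep q.X.obj ⟶ G.obj := q.π.hom
  obtain ⟨a, ha⟩ := q.surjective p.X.obj (α.hom.app _ (p'.app p.X.obj (𝟙 p.X.obj)))
  refine ⟨ObjectProperty.homMk a, ?_⟩
  ext1
  refine (rep_presents_id p.X.obj).hom_ext (F := rep p.X.obj) ?_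
  exact (congrArg (q'.app p.X.obj) (Category.comp_id (show q.X.obj ⟶ p.X.obj from a))).trans ha

/-- A contravariant functor is left exact if it carries presentations to exact sequences. -/
def IsLeftExactDual (E : (TFP S)ᵒᵖ ⥤ LeftMod R ⥤ AddCommGrpCat.{u}) : Prop :=
  ∀ (F : TFP S) (p : RepPresentation F), (∀ A, Function.Injective ((E.map p.π.op).app A)) ∧
    ExactSeq (E.map p.π.op) (E.map ((repTFP S).map p.f.op).op)

/-- Exactness in the middle is the hypothesis. Injectivity comes from the exact sequence `(X, -) ⟶ F
⟶ 0`, once the value of `E` at the zero functor is known to vanish. -/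
lemma isLeftExactDual_of_exact (E : (TFP S)ᵒᵖ ⥤ LeftMod R ⥤ AddCommGrpCat.{u})
    (hE : ∀ (F G H : TFP S) (α : F ⟶ G) (β : G ⟶ H),
      ExactSeq α.hom β.hom → ExactSeq (E.map β.op) (E.map α.op)) : IsLeftExactDual E := by
  intro F p
  refine ⟨fun A => ?_, hE _ _ _ _ _ p.exactSeq⟩
  have hP : isFPModule S (ModuleCat.of S PUnit.{u + 1}) :=
    inferInstanceAs (Module.FinitePresentation S PUnit.{u + 1})
  let Z : TFP S := (repTFP S).obj (op ⟨ModuleCat.of S PUnit.{u + 1}, hP⟩)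
  have hZ : ∀ (M : ModuleCat.{u} S) (z : Z.obj.obj M), z = 0 := by
    intro M z
    have h : ∀ h : ModuleCat.of S PUnit.{u + 1} ⟶ M, h = 0 := fun h => by
      ext
      exact map_zero h.hom
    exact h z
  have hEZ : ∀ z : (E.obj (op Z)).obj A, z = 0 := by
    intro z
    -- `E` is not assumed additive. The identities `Z ⟶ Z ⟶ Z` form an exact sequence because `Z` is
    -- zero; its image under `E` is exact, which forces the identity of `E(Z)` to be zero.
    have h := hE Z Z Z (𝟙 Z) (𝟙 Z) fun M z => ⟨fun _ => ⟨z, rfl⟩, fun _ => hZ M _⟩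
    have h1 : ∀ y, (E.map (𝟙 Z).op).app A y = y := fun y => by
      rw [op_id, CategoryTheory.Functor.map_id]; rfl
    rw [← h1 z]
    exact (h A z).2 ⟨z, h1 z⟩
  have h := hE _ F Z p.π 0 fun M z => ⟨fun _ => p.surjective M z, fun _ => rfl⟩
  rw [injective_iff_map_eq_zero]
  intro x hx
  obtain ⟨z, rfl⟩ := (h A x).1 hx
  rw [hEZ z, map_zero]

/-- A map between left exact contravariant functors is determined by its restriction to
representable functors. -/
lemma exists_extension_of_rep {E E' : (TFP S)ᵒᵖ ⥤ LeftMod R ⥤ AddCommGrpCat.{u}}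
    (hE : IsLeftExactDual E) (hE' : IsLeftExactDual E') (p : ∀ F : TFP S, RepPresentation F)
    (t : (repTFP S).rightOp ⋙ E ⟶ (repTFP S).rightOp ⋙ E') :
    ∃ v : E ⟶ E', ∀ F : TFP S,
      v.app (op F) ≫ E'.map (p F).π.op = E.map (p F).π.op ≫ t.app (p F).X := by
  have h1 : ∀ (F : TFP S) (A : LeftMod R) (x : (E.obj (op F)).obj A),
      ∃ y, (E'.map (p F).π.op).app A y = (t.app (p F).X).app A ((E.map (p F).π.op).app A x) := by
    intro F A x
    -- The values of `E` and `E'` at `F` are kernels of maps between values at representables, and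
    -- naturality of `t` at the presenting map carries one kernel into the other.
    refine ((hE' F (p F)).2 A _).1 ?_
    have h2 := ConcreteCategory.congr_hom (NatTrans.congr_app (t.naturality (p F).f) A)
      ((E.map (p F).π.op).app A x)
    refine h2.symm.trans ?_
    refine (congrArg ((t.app (p F).Y).app A) (((hE F (p F)).2 A _).2 ⟨x, rfl⟩)).trans ?_
    exact map_zero _
  choose s hs using h1
  have hinj := fun F => (hE' F (p F)).1
  let v (F : TFP S) : E.obj (op F) ⟶ E'.obj (op F) :=
    { app := fun A => AddCommGrpCat.ofHom (AddMonoidHom.mk' (s F A) fun x y => by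
        apply hinj
        rw [map_add, hs, hs, hs, map_add, map_add])
      naturality := fun A B g => by
        ext x
        apply hinj
        change (E'.map (p F).π.op).app B (s F B ((E.obj (op F)).map g x)) =
          (E'.map (p F).π.op).app B ((E'.obj (op F)).map g (s F A x))
        rw [hs, nat_apply, nat_apply, hs]
        exact nat_apply (t.app (p F).X) g _ }
  have hv : ∀ F, v F ≫ E'.map (p F).π.op = E.map (p F).π.op ≫ t.app (p F).X := by
    intro F
    ext A x
    exact hs F A x
  refine ⟨{ app := fun F => v F.unop, naturality := fun G F α => ?_ }, hv⟩
  -- Naturality at `α` is checked after the monomorphism `E'(π)`; there `α` may be replaced by a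
  -- lift `a` to representables, where `t` is natural.
  obtain ⟨a, ha⟩ := (p F.unop).exists_lift (p G.unop) α.unop
  have hmono : Mono (E'.map (p F.unop).π.op) := by
    have : ∀ A, Mono ((E'.map (p F.unop).π.op).app A) := fun A =>
      (AddCommGrpCat.mono_iff_injective _).2 (hinj F.unop A)
    exact NatTrans.mono_of_mono_app _
  have ha' : α ≫ (p F.unop).π.op = (p G.unop).π.op ≫ ((repTFP S).map a.op).op := by
    apply Quiver.Hom.unop_inj
    exact ha.symm
  have ht : E.map ((repTFP S).map a.op).op ≫ t.app (p F.unop).X =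
    t.app (p G.unop).X ≫ E'.map ((repTFP S).map a.op).op := t.naturality a
  rw [← cancel_mono (E'.map (p F.unop).π.op), Category.assoc, Category.assoc, hv,
    ← Functor.map_comp, ha', ← Functor.map_comp_assoc, ha', Functor.map_comp, Functor.map_comp,
    Category.assoc, ht, ← Category.assoc, ← Category.assoc, hv]

/-- Exact contravariant functors that agree on representable functors are isomorphic. -/
lemma nonempty_iso_of_rep {E E' : (TFP S)ᵒᵖ ⥤ TFP R}
    (hE : IsLeftExactDual (E ⋙ (isTFP R).ι)) (hE' : IsLeftExactDual (E' ⋙ (isTFP R).ι))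
    (t : (repTFP S).rightOp ⋙ E ⋙ (isTFP R).ι ≅ (repTFP S).rightOp ⋙ E' ⋙ (isTFP R).ι) :
    Nonempty (E ≅ E') := by
  let p (F : TFP S) := (nonempty_repPresentation F).some
  obtain ⟨v, hv⟩ := exists_extension_of_rep hE hE' p t.hom
  obtain ⟨w, hw⟩ := exists_extension_of_rep hE' hE p t.inv
  have hmono : ∀ {E : (TFP S)ᵒᵖ ⥤ LeftMod R ⥤ AddCommGrpCat.{u}} (_ : IsLeftExactDual E)
      (F : TFP S), Mono (E.map (p F).π.op) := by
    intro E hE F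
    have : ∀ A, Mono ((E.map (p F).π.op).app A) := fun A =>
      (AddCommGrpCat.mono_iff_injective _).2 ((hE F (p F)).1 A)
    exact NatTrans.mono_of_mono_app _
  -- Extensions are unique: after the monomorphism `E(π)` the composite becomes `t` followed by its
  -- inverse.
  have h1 : v ≫ w = 𝟙 _ := by
    ext1; ext1 F
    have := hmono hE F.unop
    rw [← cancel_mono ((E ⋙ (isTFP R).ι).map (p F.unop).π.op), NatTrans.comp_app, Category.assoc]
    refine (congrArg (v.app F ≫ ·) (hw F.unop)).trans ?_
    rw [← Category.assoc]
    refine (congrArg (· ≫ t.inv.app (p F.unop).X) (hv F.unop)).trans ?_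
    rw [Category.assoc, t.hom_inv_id_app, NatTrans.id_app, Category.id_comp]
    exact Category.comp_id _
  have h2 : w ≫ v = 𝟙 _ := by
    ext1; ext1 F
    have := hmono hE' F.unop
    rw [← cancel_mono ((E' ⋙ (isTFP R).ι).map (p F.unop).π.op), NatTrans.comp_app, Category.assoc]
    refine (congrArg (w.app F ≫ ·) (hv F.unop)).trans ?_
    rw [← Category.assoc]
    refine (congrArg (· ≫ t.hom.app (p F.unop).X) (hw F.unop)).trans ?_
    rw [Category.assoc, t.inv_hom_id_app, NatTrans.id_app, Category.id_comp]
    exact Category.comp_id _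
  let i : E ⋙ (isTFP R).ι ≅ E' ⋙ (isTFP R).ι := ⟨v, w, h1, h2⟩
  exact ⟨NatIso.ofComponents (fun F => (isTFP R).isoMk (i.app F)) fun {F G} α => by
    ext1
    exact i.hom.naturality α⟩

end ExactFunctors

end Uniqueness

end

end FunctorDuality

/-- The duality `D : tfp(Mod(R), Ab) → tfp(Mod(R^op), Ab)` obtained by restricting the zeroth
left derived functor of `F ↦ (F(R), -)` is the Auslander–Gruson–Jensen duality. -/
theorem mainTheorem5 (R : Type u) [Ring R] (hR : IsCoherentRing R) :
    -- the derived functor carries totally finitely presented functors to such functors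
    ∃ hD : ∀ F : (TFP Rᵐᵒᵖ)ᵒᵖ,
      isTFP R ((dualFunctor R).obj (op ((tfpToFP Rᵐᵒᵖ).obj F.unop))).obj,
    -- `D` is its restriction, and it is a duality
    let D : (TFP Rᵐᵒᵖ)ᵒᵖ ⥤ TFP R :=
      (isTFP R).lift ((tfpToFP Rᵐᵒᵖ).op ⋙ dualFunctor R ⋙ isFP.ι) hD
    D.IsEquivalence ∧
    -- `DF(A) ≅ Nat(F, - ⊗ A)`, naturally in `F` and `A`
    (∃ e : ∀ (F : TFP Rᵐᵒᵖ) (A : LeftMod R),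
        (D.obj (op F)).obj.obj A ≃+ (F.obj ⟶ (tensor R).obj A),
      (∀ (F G : TFP Rᵐᵒᵖ) (α : F ⟶ G) (A : LeftMod R) (x : (D.obj (op G)).obj.obj A),
        e F A ((D.map α.op).hom.app A x) = α.hom ≫ e G A x) ∧
      (∀ (F : TFP Rᵐᵒᵖ) (A B : LeftMod R) (g : A ⟶ B) (x : (D.obj (op F)).obj.obj A),
        e F B ((D.obj (op F)).obj.map g x) = e F A x ≫ (tensor R).map g) ∧
      -- the same with functors and transformations on finitely presented modules only
      (∀ (F : TFP Rᵐᵒᵖ) (A : FPMod R), Function.Bijective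
        fun x : (D.obj (op F)).obj.obj A.obj =>
          Functor.whiskerLeft (isFPModule Rᵐᵒᵖ).ι (e F A.obj x)) ∧
      -- duality of pairs of positive primitive formulas
      (∀ (n : ℕ) (φ ψ : PPFormula Rᵐᵒᵖ n), (∀ M, ψ.sol M ≤ φ.sol M) →
        (∀ N, φ.dual.sol N ≤ ψ.dual.sol N) ∧
        ∃ (hF : isTFP Rᵐᵒᵖ (ppPair φ ψ))
          (i : (D.obj (op ⟨ppPair φ ψ, hF⟩)).obj ≅ ppPair ψ.dual φ.dual),
          ∀ (M : RightMod R) (N : LeftMod R) (a : φ.sol M) (b : ψ.dual.sol N),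
            (e ⟨ppPair φ ψ, hF⟩ N (i.inv.app N (QuotientAddGroup.mk b))).app M
              (QuotientAddGroup.mk a) = ∑ k, tmul (a.1 k) (b.1 k))) ∧
    -- every totally finitely presented functor is given by a pair of positive primitive formulas
    (∀ F : TFP Rᵐᵒᵖ, ∃ (n : ℕ) (φ ψ : PPFormula Rᵐᵒᵖ n),
      (∀ M, ψ.sol M ≤ φ.sol M) ∧ Nonempty (F.obj ≅ ppPair φ ψ)) ∧
    -- `0 ⟶ DF ⟶ X ⊗ - ⟶ Y ⊗ -` is exact for every presentation of `F`
    (∃ θ : (repTFP Rᵐᵒᵖ).rightOp ⋙ D ⋙ (isTFP R).ι ≅ (isFPModule Rᵐᵒᵖ).ι ⋙ (tensor R).flip,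
      ∀ (F : TFP Rᵐᵒᵖ) (X Y : FPMod Rᵐᵒᵖ) (f : X ⟶ Y) (π : (repTFP Rᵐᵒᵖ).obj (op X) ⟶ F),
        ExactSeq ((repTFP Rᵐᵒᵖ).map f.op).hom π.hom →
        (∀ M, Function.Surjective (π.hom.app M)) →
        (∀ A, Function.Injective (((D.map π.op).hom ≫ θ.hom.app X).app A)) ∧
        ExactSeq ((D.map π.op).hom ≫ θ.hom.app X) ((tensor R).flip.map f.hom)) ∧
    -- `D` is exact, and it is the only exact contravariant functor with `D(X, -) ≅ X ⊗ -`
    (∀ (F G H : TFP Rᵐᵒᵖ) (α : F ⟶ G) (β : G ⟶ H),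
      ExactSeq α.hom β.hom → ExactSeq (D.map β.op).hom (D.map α.op).hom) ∧
    (∀ E : (TFP Rᵐᵒᵖ)ᵒᵖ ⥤ TFP R,
      (∀ (F G H : TFP Rᵐᵒᵖ) (α : F ⟶ G) (β : G ⟶ H),
        ExactSeq α.hom β.hom → ExactSeq (E.map β.op).hom (E.map α.op).hom) →
      Nonempty ((repTFP Rᵐᵒᵖ).rightOp ⋙ E ⋙ (isTFP R).ι ≅
        (isFPModule Rᵐᵒᵖ).ι ⋙ (tensor R).flip) →
      Nonempty (E ≅ D)) := by
  refine ⟨fun F => isTFP_restrictedDual F.unop, ?_⟩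
  intro D
  let T : TensorDuality (D ⋙ (isTFP R).ι) := dualTensorDuality R
  refine ⟨T.isEquivalence, ⟨T.e, fun F G α A x => T.map_left α A x, fun F A B g x => (T.represents F).equiv_map g x,
    fun F A => T.bijective_whiskerLeft F A.obj, fun n φ ψ h => ⟨PPFormula.dual_sol_le h, ?_⟩⟩,
    exists_iso_ppPair, ⟨T.repIso, T.exactSeq_repIso⟩, fun F G H α β h => T.exactSeq_map α β h, ?_⟩
  · obtain ⟨i, hi⟩ := T.exists_iso_ppPair_dual φ ψ (isTFP_ppPair φ ψ)
    refine ⟨isTFP_ppPair φ ψ, i, fun M N a b => ?_⟩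
    exact (ConcreteCategory.congr_hom (NatTrans.congr_app (hi N b) M) (ppMk φ ψ a)).trans
      (pairingHom_app b a)
  · rintro E hE ⟨θ⟩
    -- Both functors are exact, hence left exact in the required sense, and both restrict to `X ⊗ -`
    -- on representables.
    exact nonempty_iso_of_rep (isLeftExactDual_of_exact (E ⋙ (isTFP R).ι) hE)
      (isLeftExactDual_of_exact (D ⋙ (isTFP R).ι) fun F G H α β h => T.exactSeq_map α β h)
      (θ ≪≫ T.repIso.symm)
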